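/- Let $\mathbb{T}\subseteq\mathbb{R}$ be a time scale (a nonempty closed set) with $\sup\mathbb{T}=+\infty$, let $a\in\mathbb{T}$, $n\in\mathbb{N}$, $x_a\in\mathbb{R}^n$. All intervals are intersected with $\mathbb{T}$, and $T,T',t$ range over $\mathbb{T}$. Let $\sigma,\rho$ be the forward and backward jump operators (with $\rho(\min\mathbb{T})=\min\mathbb{T}$ if the minimum exists), $\nu(t)=t-\rho(t)$, $x^\rho=x\circ\rho$, and let $x^\nabla$ be the nabla derivative. $\mathbb{T}_\kappa$ is $\mathbb{T}$ without its right-scattered minimum, if there is one. A function is ld-continuous if it is continuous at left-dense points ($\rho(t)=t$) and has finite right-sided limits at right-dense points ($\sigma(t)=t$). $C^1_{ld}(\mathbb{T},\mathbb{R}^n)$ is the set of functions that are nabla differentiable on $\mathbb{T}_\kappa$ with ld-continuous nabla derivative. $\int_b^c f(t)\nabla t=F(c)-F(b)$, where $F^\nabla=f$ on $\mathbb{T}_\kappa$. Let $L(t,u,v,w)$ and $g(t,u,v)$ ($t\in\mathbb{T}$, $u,v\in\mathbb{R}^n$, $w\in\mathbb{R}$) be real-valued, $C^1$ in $(u,v,w)$,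 respectively $(u,v)$, for each $t$. Assume that $L$, $g$ and these derivatives are ld-continuous in $t$ jointly with the other variables $y$: they are jointly continuous at $(t,y)$ if $t$ is left-dense, and have a finite limit as $(s,y')\to(t^+,y)$ if $t$ is right-dense. Denote by $L_x,L_v,L_z$ (resp. $g_x,g_v$) the partial derivatives with respect to $u,v,w$ (resp. $u,v$). For a path $x$ put $\langle x\rangle(t)=(t,x^\rho(t),x^\nabla(t))$, $z(t)=\int_a^t g\langle x\rangle(\tau)\nabla\tau$ and $[x,z](t)=(t,x^\rho(t),x^\nabla(t),z(t))$, and write $g\langle x\rangle(t)$, $L[x,z](t)$ etc. for the values of these functions at those arguments. Consider the problem $$\int_a^\infty L[x,z](t)\,\nabla t\longrightarrow\max,\qquad x(a)=x_a .$$ A path $x$ is admissible if $x\in C^1_{ld}(\mathbb{T},\mathbb{R}^n)$ and $x(a)=x_a$. An admissible path $x_\star$ (with $z_\star$ the corresponding $z$) is a weak maximizer if $\lim_{T\to\infty}\inf_{T'\ge T}\int_a^{T'}(L[x,z](t)-L[x_\star,z_\star](t))\nabla t\le 0$ for every admissible $x$ (with limit and infimum in $[-\infty,\infty]$). **Theorem.**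 Let $x_\star$ be a weak maximizer such that $t\mapsto L_v[x_\star,z_\star](t)$ and $t\mapsto g_v\langle x_\star\rangle(t)$ are nabla differentiable on $\mathbb{T}_\kappa$. For $p\in C^1_{ld}(\mathbb{T},\mathbb{R}^n)$ with $p(a)=0$ and $\varepsilon\ne0$ put $$A(\varepsilon,T')=\int_a^{T'}\frac{L\bigl(t,x_\star^\rho+\varepsilon p^\rho,x_\star^\nabla+\varepsilon p^\nabla,\int_a^t g\langle x_\star+\varepsilon p\rangle(\tau)\nabla\tau\bigr)-L[x_\star,z_\star](t)}{\varepsilon}\nabla t,\qquad V(\varepsilon,T)=\inf_{T'\ge T}\varepsilon A(\varepsilon,T')\in[-\infty,\infty).$$ Suppose that for every such $p$: 1. for every $T>a$, $\lim_{\varepsilon\to0}V(\varepsilon,T)/\varepsilon$ exists (as a finite number); 2. for some $\varepsilon_0>0$, $\lim_{T\to\infty}V(\varepsilon,T)/\varepsilon$ exists (finitely) uniformly for $0<|\varepsilon|<\varepsilon_0$; 3. for every $T>a$ there are $\varepsilon_0>0$ and a sequence $T'_k\ge T$ such that $\inf_{T'\ge T}A(\varepsilon,T')$ is finite for $0<\varepsilon<\varepsilon_0$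 and $A(\varepsilon,T'_k)\to\inf_{T'\ge T}A(\varepsilon,T')$ as $k\to\infty$, uniformly for $0<\varepsilon<\varepsilon_0$. Then, with $x=x_\star$, $z=z_\star$, the Euler–Lagrange system of $n$ equations (understood componentwise) $$\lim_{T\to\infty}\inf_{T'\ge T}\Bigl\{g_x\langle x\rangle(t)\int_{\rho(t)}^{T'}L_z[x,z](\tau)\nabla\tau-\Bigl(g_v\langle x\rangle(t)\int_{\rho(t)}^{T'}L_z[x,z](\tau)\nabla\tau\Bigr)^{\nabla}\Bigr\}+L_x[x,z](t)-L_v^\nabla[x,z](t)=0$$ holds, all the nabla derivatives in it existing (for every $T'\in\mathbb{T}$), at every $t\in\mathbb{T}$ with $\rho(t)>a$, and also at $t=a$ if $a=\min\mathbb{T}$ is right-dense. If $\rho(a)=a=\sigma(a)$, it also holds at $t=a$ provided that $s\mapsto g_v\langle x\rangle(s)\int_{\rho(s)}^{T'}L_z[x,z](\tau)\nabla\tau$ is nabla differentiable at $a$ for every $T'\in\mathbb{T}$. Moreover the transversality condition $$\lim_{T\to\infty}\inf_{T'\ge T}\bigl\{x(T')\cdot\bigl[L_v[x,z](T')+g_v\langle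 x\rangle(T')\,\nu(T')\,L_z[x,z](T')\bigr]\bigr\}=0$$ holds. -/

import Mathlib

open Set Filter Topology

namespace TimeScale

/-! ## Nabla calculus on a time scale

A time scale is a nonempty closed set `𝕋 ⊆ ℝ`. Functions on `𝕋` are represented by functions on `ℝ`;
every notion below depends only on their values at points of `𝕋`. -/

/-- Backward jump operator `ρ(t) = sup {s ∈ 𝕋 : s < t}`, with `ρ(min 𝕋) = min 𝕋`. -/
noncomputable def rho (𝕋 : Set ℝ) (t : ℝ) : ℝ :=
  open Classical in if (𝕋 ∩ Iio t).Nonempty then sSup (𝕋 ∩ Iio t) else t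

/-- Forward jump operator `σ(t) = inf {s ∈ 𝕋 : s > t}`, with `σ(max 𝕋) = max 𝕋`. -/
noncomputable def sigma (𝕋 : Set ℝ) (t : ℝ) : ℝ :=
  open Classical in if (𝕋 ∩ Ioi t).Nonempty then sInf (𝕋 ∩ Ioi t) else t

/-- Backward graininess `ν(t) = t - ρ(t)`. -/
noncomputable def nu (𝕋 : Set ℝ) (t : ℝ) : ℝ := t - rho 𝕋 t

/-- `𝕋_κ`: the time scale without its right-scattered minimum, if there is one. -/
def kappa (𝕋 : Set ℝ) : Set ℝ := {t ∈ 𝕋 | ¬ (IsLeast 𝕋 t ∧ t < sigma 𝕋 t)}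

section Calculus

variable {F : Type*} [NormedAddCommGroup F] [NormedSpace ℝ F]

/-- The defining inequality of the nabla derivative at `t`. -/
def HasNablaDerivAt (𝕋 : Set ℝ) (f : ℝ → F) (f' : F) (t : ℝ) : Prop :=
  ∀ ε : ℝ, 0 < ε → ∀ᶠ s in 𝓝[𝕋] t,
    ‖f (rho 𝕋 t) - f s - (rho 𝕋 t - s) • f'‖ ≤ ε * |rho 𝕋 t - s|

/-- `f` is nabla differentiable at `t` (which includes `t ∈ 𝕋_κ`). -/
def NablaDifferentiableAt (𝕋 : Set ℝ) (f : ℝ → F) (t : ℝ) : Prop :=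
  t ∈ kappa 𝕋 ∧ ∃ f' : F, HasNablaDerivAt 𝕋 f f' t

/-- `f` is nabla differentiable on `𝕋`. -/
def NablaDifferentiable (𝕋 : Set ℝ) (f : ℝ → F) : Prop :=
  ∀ t ∈ kappa 𝕋, NablaDifferentiableAt 𝕋 f t

/-- The nabla derivative `f^∇(t)` (zero where it does not exist). -/
noncomputable def nablaDeriv (𝕋 : Set ℝ) (f : ℝ → F) (t : ℝ) : F :=
  open Classical in if h : NablaDifferentiableAt 𝕋 f t then h.2.choose else 0

/-- `f` is ld-continuous: continuous at left-dense points, with (finite) right-sided limits at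
right-dense points. -/
def LdContinuous (𝕋 : Set ℝ) (f : ℝ → F) : Prop :=
  ∀ t ∈ 𝕋, (rho 𝕋 t = t → ContinuousWithinAt f 𝕋 t) ∧
    (sigma 𝕋 t = t → ∃ l : F, Tendsto f (𝓝[𝕋 ∩ Ioi t] t) (𝓝 l))

/-- The class `C¹_ld(𝕋, F)`. -/
def IsC1ld (𝕋 : Set ℝ) (f : ℝ → F) : Prop :=
  NablaDifferentiable 𝕋 f ∧ LdContinuous 𝕋 (nablaDeriv 𝕋 f)

/-- `G` is a nabla antiderivative of `f`. -/
def IsNablaAntideriv (𝕋 : Set ℝ) (f G : ℝ → ℝ) : Prop :=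
  ∀ t ∈ kappa 𝕋, HasNablaDerivAt 𝕋 G (f t) t

/-- The nabla integral `∫_a^b f(t) ∇t = G(b) - G(a)`, where `G` is a nabla antiderivative of `f`
(zero if there is none). -/
noncomputable def nablaIntegral (𝕋 : Set ℝ) (f : ℝ → ℝ) (a b : ℝ) : ℝ :=
  open Classical in
  if h : ∃ G : ℝ → ℝ, IsNablaAntideriv 𝕋 f G then h.choose b - h.choose a else 0

/-- `lim_{T → ∞} inf_{T' ≥ T} f(T')`, with `T, T' ∈ 𝕋`, in the extended reals. -/
noncomputable def limInf (𝕋 : Set ℝ) (f : ℝ → ℝ) : EReal :=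
  Filter.liminf (fun T' => ((f T' : ℝ) : EReal)) (atTop ⊓ 𝓟 𝕋)

/-- `f(t, y)` is ld-continuous in `t`, jointly with continuity in the parameter `y`. -/
def JointlyLdContinuous {Y : Type*} [TopologicalSpace Y] (𝕋 : Set ℝ) (f : ℝ → Y → F) : Prop :=
  ∀ t ∈ 𝕋, ∀ y : Y,
    (rho 𝕋 t = t → ContinuousWithinAt (fun q : ℝ × Y => f q.1 q.2) (𝕋 ×ˢ univ) (t, y)) ∧
    (sigma 𝕋 t = t → ∃ l : F,
      Tendsto (fun q : ℝ × Y => f q.1 q.2) (𝓝[𝕋 ∩ Ioi t] t ×ˢ 𝓝 y) (𝓝 l))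

/-- `f(t, ·)` is `C¹` for each `t ∈ 𝕋`, and `f` and its derivative with respect to the parameter are
ld-continuous in `t`, jointly with the parameter. -/
def IsC1ldIntegrand {Y : Type*} [NormedAddCommGroup Y] [NormedSpace ℝ Y]
    (𝕋 : Set ℝ) (f : ℝ → Y → ℝ) : Prop :=
  (∀ t ∈ 𝕋, ContDiff ℝ 1 (f t)) ∧ JointlyLdContinuous 𝕋 f ∧
    JointlyLdContinuous 𝕋 (fun t y => fderiv ℝ (f t) y)

end Calculus

/-! ## The variational problem

The Lagrangian is `L(t, (u, v, w))` and the inner integrand is `g(t, (u, v))`. -/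

section Problem

variable {n : ℕ}

/-- Partial gradient `L_x` with respect to `u`. -/
noncomputable def Lx (L : ℝ → EuclideanSpace ℝ (Fin n) × EuclideanSpace ℝ (Fin n) × ℝ → ℝ)
    (t : ℝ) (y : EuclideanSpace ℝ (Fin n) × EuclideanSpace ℝ (Fin n) × ℝ) :
    EuclideanSpace ℝ (Fin n) :=
  gradient (fun u => L t (u, y.2.1, y.2.2)) y.1

/-- Partial gradient `L_v` with respect to `v`. -/
noncomputable def Lv (L : ℝ → EuclideanSpace ℝ (Fin n) × EuclideanSpace ℝ (Fin n) × ℝ → ℝ)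
    (t : ℝ) (y : EuclideanSpace ℝ (Fin n) × EuclideanSpace ℝ (Fin n) × ℝ) :
    EuclideanSpace ℝ (Fin n) :=
  gradient (fun v => L t (y.1, v, y.2.2)) y.2.1

/-- Partial derivative `L_z` with respect to `w`. -/
noncomputable def Lz (L : ℝ → EuclideanSpace ℝ (Fin n) × EuclideanSpace ℝ (Fin n) × ℝ → ℝ)
    (t : ℝ) (y : EuclideanSpace ℝ (Fin n) × EuclideanSpace ℝ (Fin n) × ℝ) : ℝ :=
  deriv (fun w => L t (y.1, y.2.1, w)) y.2.2

/-- Partial gradient `g_x` with respect to `u`. -/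
noncomputable def gx (g : ℝ → EuclideanSpace ℝ (Fin n) × EuclideanSpace ℝ (Fin n) → ℝ)
    (t : ℝ) (y : EuclideanSpace ℝ (Fin n) × EuclideanSpace ℝ (Fin n)) :
    EuclideanSpace ℝ (Fin n) :=
  gradient (fun u => g t (u, y.2)) y.1

/-- Partial gradient `g_v` with respect to `v`. -/
noncomputable def gv (g : ℝ → EuclideanSpace ℝ (Fin n) × EuclideanSpace ℝ (Fin n) → ℝ)
    (t : ℝ) (y : EuclideanSpace ℝ (Fin n) × EuclideanSpace ℝ (Fin n)) :
    EuclideanSpace ℝ (Fin n) :=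
  gradient (fun v => g t (y.1, v)) y.2

/-- The arguments `(x^ρ(t), x^∇(t))` of `g⟨x⟩(t)`. -/
noncomputable def jet (𝕋 : Set ℝ) (x : ℝ → EuclideanSpace ℝ (Fin n)) (t : ℝ) :
    EuclideanSpace ℝ (Fin n) × EuclideanSpace ℝ (Fin n) :=
  (x (rho 𝕋 t), nablaDeriv 𝕋 x t)

/-- `z(t) = ∫_a^t g(τ, x^ρ(τ), x^∇(τ)) ∇τ`. -/
noncomputable def zPath (𝕋 : Set ℝ) (a : ℝ)
    (g : ℝ → EuclideanSpace ℝ (Fin n) × EuclideanSpace ℝ (Fin n) → ℝ)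
    (x : ℝ → EuclideanSpace ℝ (Fin n)) (t : ℝ) : ℝ :=
  nablaIntegral 𝕋 (fun τ => g τ (jet 𝕋 x τ)) a t

/-- The arguments `(x^ρ(t), x^∇(t), z(t))` of `L[x, z](t)`. -/
noncomputable def jetz (𝕋 : Set ℝ) (a : ℝ)
    (g : ℝ → EuclideanSpace ℝ (Fin n) × EuclideanSpace ℝ (Fin n) → ℝ)
    (x : ℝ → EuclideanSpace ℝ (Fin n)) (t : ℝ) :
    EuclideanSpace ℝ (Fin n) × EuclideanSpace ℝ (Fin n) × ℝ :=
  (x (rho 𝕋 t), nablaDeriv 𝕋 x t, zPath 𝕋 a g x t)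

/-- Admissible paths: `x ∈ C¹_ld(𝕋, ℝⁿ)` with `x(a) = x_a`. -/
def IsAdmissible (𝕋 : Set ℝ) (a : ℝ) (xa : EuclideanSpace ℝ (Fin n))
    (x : ℝ → EuclideanSpace ℝ (Fin n)) : Prop :=
  IsC1ld 𝕋 x ∧ x a = xa

/-- Weak maximizers: `lim_{T → ∞} inf_{T' ≥ T} ∫_a^{T'} (L[x, z] - L[x⋆, z⋆]) ∇t ≤ 0` for all
admissible paths `x`. -/
def IsWeakMaximizer (𝕋 : Set ℝ) (a : ℝ) (xa : EuclideanSpace ℝ (Fin n))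
    (L : ℝ → EuclideanSpace ℝ (Fin n) × EuclideanSpace ℝ (Fin n) × ℝ → ℝ)
    (g : ℝ → EuclideanSpace ℝ (Fin n) × EuclideanSpace ℝ (Fin n) → ℝ)
    (xs : ℝ → EuclideanSpace ℝ (Fin n)) : Prop :=
  IsAdmissible 𝕋 a xa xs ∧ ∀ x : ℝ → EuclideanSpace ℝ (Fin n), IsAdmissible 𝕋 a xa x →
    limInf 𝕋 (fun T' =>
      nablaIntegral 𝕋 (fun t => L t (jetz 𝕋 a g x t) - L t (jetz 𝕋 a g xs t)) a T') ≤ 0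

/-- The difference quotient `A(ε, T')` in the direction `p`. -/
noncomputable def quotA (𝕋 : Set ℝ) (a : ℝ)
    (L : ℝ → EuclideanSpace ℝ (Fin n) × EuclideanSpace ℝ (Fin n) × ℝ → ℝ)
    (g : ℝ → EuclideanSpace ℝ (Fin n) × EuclideanSpace ℝ (Fin n) → ℝ)
    (xs p : ℝ → EuclideanSpace ℝ (Fin n)) (ε T' : ℝ) : ℝ :=
  nablaIntegral 𝕋 (fun t =>
    (L t (xs (rho 𝕋 t) + ε • p (rho 𝕋 t), nablaDeriv 𝕋 xs t + ε • nablaDeriv 𝕋 p t,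
        zPath 𝕋 a g (fun s => xs s + ε • p s) t)
      - L t (jetz 𝕋 a g xs t)) / ε) a T'

/-- `V(ε, T) = inf_{T' ≥ T} ε A(ε, T')`, in the extended reals. -/
noncomputable def infV (𝕋 : Set ℝ) (a : ℝ)
    (L : ℝ → EuclideanSpace ℝ (Fin n) × EuclideanSpace ℝ (Fin n) × ℝ → ℝ)
    (g : ℝ → EuclideanSpace ℝ (Fin n) × EuclideanSpace ℝ (Fin n) → ℝ)
    (xs p : ℝ → EuclideanSpace ℝ (Fin n)) (ε T : ℝ) : EReal :=
  ⨅ T' ∈ 𝕋 ∩ Ici T, ((ε * quotA 𝕋 a L g xs p ε T' : ℝ) : EReal)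

/-- The `g_v`-term `s ↦ g_v⟨x⟩(s) ∫_{ρ(s)}^{T'} L_z[x, z](τ) ∇τ`. -/
noncomputable def gvTerm (𝕋 : Set ℝ) (a : ℝ)
    (L : ℝ → EuclideanSpace ℝ (Fin n) × EuclideanSpace ℝ (Fin n) × ℝ → ℝ)
    (g : ℝ → EuclideanSpace ℝ (Fin n) × EuclideanSpace ℝ (Fin n) → ℝ)
    (x : ℝ → EuclideanSpace ℝ (Fin n)) (T' s : ℝ) : EuclideanSpace ℝ (Fin n) :=
  nablaIntegral 𝕋 (fun τ => Lz L τ (jetz 𝕋 a g x τ)) (rho 𝕋 s) T' • gv g s (jet 𝕋 x s)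

/-- The Euler–Lagrange system of `n` equations at the point `t`. -/
def EulerLagrangeAt (𝕋 : Set ℝ) (a : ℝ)
    (L : ℝ → EuclideanSpace ℝ (Fin n) × EuclideanSpace ℝ (Fin n) × ℝ → ℝ)
    (g : ℝ → EuclideanSpace ℝ (Fin n) × EuclideanSpace ℝ (Fin n) → ℝ)
    (x : ℝ → EuclideanSpace ℝ (Fin n)) (t : ℝ) : Prop :=
  ∀ i : Fin n,
    limInf 𝕋 (fun T' =>
        (nablaIntegral 𝕋 (fun τ => Lz L τ (jetz 𝕋 a g x τ)) (rho 𝕋 t) T' • gx g t (jet 𝕋 x t)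
          - nablaDeriv 𝕋 (gvTerm 𝕋 a L g x T') t) i)
      + (((Lx L t (jetz 𝕋 a g x t)
          - nablaDeriv 𝕋 (fun s => Lv L s (jetz 𝕋 a g x s)) t) i : ℝ) : EReal) = 0

end Problem

end TimeScale

/-! The first variation at a weak maximizer vanishes at every finite horizon `T > a`. Since `x + ε
p` is admissible, `V(ε, T) ≤ 0` for both signs of `ε`; hence the two-sided limit `l` of `V(ε, T) /
ε` is at most `0` from the right and at least `0` from the left, so `l = 0`. Choosing `T' = T` in
the infimum gives `V(ε, T) ≤ ε A(ε, T)`. Dividing by `ε` on either side of `0`, and using that `A(ε,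
T)` tends to the first variation, squeezes the latter between `l` and `l`
(`IsWeakMaximizer.firstVar_eq_zero`).

Write `K(T) = ∫_a^T L_z`. Integration by parts (`firstVar_eq`) turns the first variation, for any
constant `k`, into `(K(T) - k) β(T) + α(T)`. Here `β` pairs `p` with `(g_x, g_v)`, and `α` pairs `p`
with `L_x + (k - K^ρ) g_x` and `L_v + (k - K^ρ) g_v`. Consider the `p` that vanish from some `B` on.
Either `β(B) = 0` for all of them, or one of them has `β(B) ≠ 0`. In the second case `α` and `β` are
constant beyond `B`, which forces `K` to be constant there; `k` is taken to be that constant. In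
both cases `α` vanishes at some horizon for every such `p`, and the du Bois-Reymond lemma
(`exists_eq_add_antideriv`) gives an integrated Euler–Lagrange equation on `(a, ∞)`; in the first
case it gives one for `g` as well (`exists_integrated_equations`).

Differentiating the integrated equation leaves a single term depending on `T'`, namely `(K(T') - k)
(g_x - g_v^∇)`. One of its factors vanishes for large `T'`, so the lower limits are limits of
eventually constant functions. Transversality follows from the same decomposition with a `p` that
equals `x` from some point on. -/

namespace TimeScale

/-! ### Jump operators and neighbourhoods in a time scale -/

section Jumps

variable {𝕋 : Set ℝ} {s t : ℝ}

lemma le_rho (hs : s ∈ 𝕋) (hst : s < t) : s ≤ rho 𝕋 t := by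
  have hne : (𝕋 ∩ Iio t).Nonempty := ⟨s, hs, hst⟩
  rw [rho, if_pos hne]
  exact le_csSup ⟨t, fun u hu => hu.2.le⟩ ⟨hs, hst⟩

lemma rho_le (𝕋 : Set ℝ) (t : ℝ) : rho 𝕋 t ≤ t := by
  rw [rho]
  split_ifs with h
  · exact csSup_le h fun u hu => hu.2.le
  · exact le_rfl

lemma rho_mem (h𝕋 : IsClosed 𝕋) (ht : t ∈ 𝕋) : rho 𝕋 t ∈ 𝕋 := by
  rw [rho]
  split_ifs with h
  · exact h𝕋.closure_subset_iff.2 inter_subset_left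
      (csSup_mem_closure h ⟨t, fun u hu => hu.2.le⟩)
  · exact ht

lemma rho_eq_or_lt (𝕋 : Set ℝ) (t : ℝ) : rho 𝕋 t = t ∨ rho 𝕋 t < t :=
  (rho_le 𝕋 t).eq_or_lt

/-- Between a real number below a left-dense, non-minimal point and that point, there is a point
of the time scale. -/
lemma exists_mem_Ioo_of_rho_eq (h : rho 𝕋 t = t) (hs : s ∈ 𝕋) (hst : s < t) {r : ℝ} (hr : r < t) :
    ∃ u ∈ 𝕋, r < u ∧ u < t := by
  have hne : (𝕋 ∩ Iio t).Nonempty := ⟨s, hs, hst⟩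
  rw [rho, if_pos hne] at h
  obtain ⟨u, hu, hru⟩ := exists_lt_of_lt_csSup hne (h.symm ▸ hr)
  exact ⟨u, hu.1, hru, hu.2⟩

lemma exists_mem_gt (hsup : ¬ BddAbove 𝕋) (r : ℝ) : ∃ u ∈ 𝕋, r < u := by
  by_contra! h
  exact hsup ⟨r, h⟩

lemma sigma_le (hs : s ∈ 𝕋) (hst : t < s) : sigma 𝕋 t ≤ s := by
  have hne : (𝕋 ∩ Ioi t).Nonempty := ⟨s, hs, hst⟩
  rw [sigma, if_pos hne]
  exact csInf_le ⟨t, fun u hu => hu.2.le⟩ ⟨hs, hst⟩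

lemma le_sigma (𝕋 : Set ℝ) (t : ℝ) : t ≤ sigma 𝕋 t := by
  rw [sigma]
  split_ifs with h
  · exact le_csInf h fun u hu => hu.2.le
  · exact le_rfl

lemma exists_mem_Ioo_of_sigma_eq (h : sigma 𝕋 t = t) (hs : s ∈ 𝕋) (hst : t < s) {r : ℝ}
    (hr : t < r) : ∃ u ∈ 𝕋, t < u ∧ u < r := by
  have hne : (𝕋 ∩ Ioi t).Nonempty := ⟨s, hs, hst⟩
  rw [sigma, if_pos hne] at h
  obtain ⟨u, hu, hru⟩ := exists_lt_of_csInf_lt hne (h.symm ▸ hr)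
  exact ⟨u, hu.1, hu.2, hru⟩

lemma mem_kappa_of_lt (ht : t ∈ 𝕋) (hs : s ∈ 𝕋) (hst : s < t) : t ∈ kappa 𝕋 :=
  ⟨ht, fun h => absurd (h.1.2 hs) (not_le.2 hst)⟩

lemma mem_kappa_of_sigma_eq (ht : t ∈ 𝕋) (h : sigma 𝕋 t = t) : t ∈ kappa 𝕋 :=
  ⟨ht, fun h' => h'.2.ne' h⟩

/-- Nothing of `𝕋` lies in the gap `(ρ(t), t)`, so only the point itself and its right side remain.
Ld-continuity controls these two pieces separately. -/
lemma nhdsWithin_eq_of_rho_lt (ht : t ∈ 𝕋) (h : rho 𝕋 t < t) :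
    𝓝[𝕋] t = pure t ⊔ 𝓝[𝕋 ∩ Ioi t] t := by
  have h1 : 𝓝[𝕋] t = 𝓝[𝕋 ∩ Ioi (rho 𝕋 t)] t :=
    (nhdsWithin_inter_of_mem' (mem_nhdsWithin_of_mem_nhds (Ioi_mem_nhds h))).symm
  have h2 : 𝕋 ∩ Ioi (rho 𝕋 t) = insert t (𝕋 ∩ Ioi t) := by
    ext u
    simp only [mem_inter_iff, mem_Ioi, mem_insert_iff]
    constructor
    · rintro ⟨hu, hru⟩
      rcases lt_trichotomy u t with hut | hut | hut
      · exact absurd (le_rho hu hut) (not_le.2 hru)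
      · exact Or.inl hut
      · exact Or.inr ⟨hu, hut⟩
    · rintro (rfl | ⟨hu, hut⟩)
      · exact ⟨ht, h⟩
      · exact ⟨hu, h.trans hut⟩
  rw [h1, h2, nhdsWithin_insert]

lemma nhdsWithin_Ioi_eq_bot (h : sigma 𝕋 t ≠ t) : 𝓝[𝕋 ∩ Ioi t] t = ⊥ := by
  have h' : t < sigma 𝕋 t := lt_of_le_of_ne (le_sigma 𝕋 t) h.symm
  refine Filter.empty_mem_iff_bot.1 ?_
  have : Iio (sigma 𝕋 t) ∩ (𝕋 ∩ Ioi t) = ∅ := by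
    ext u
    simp only [mem_inter_iff, mem_Iio, mem_Ioi, mem_empty_iff_false, iff_false, not_and]
    intro hu hu1 hu2
    exact absurd (sigma_le hu1 hu2) (not_le.2 hu)
  rw [← this, inter_comm (Iio _)]
  exact inter_mem_nhdsWithin _ (Iio_mem_nhds h')

/-- A left-scattered point, or a left-dense point which is not the minimum, is approached from the
left by points different from its backward jump (possibly equal to the point itself). -/
lemma frequently_ne_rho_left (ht : t ∈ 𝕋) (hs : s ∈ 𝕋) (hst : s < t) :
    ∃ᶠ u in 𝓝[𝕋 ∩ Icc s t] t, u ≠ rho 𝕋 t := by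
  rcases rho_eq_or_lt 𝕋 t with h | h
  · rw [frequently_iff]
    intro U hU
    obtain ⟨r, hr, hrU⟩ := (mem_nhdsWithin_iff_exists_mem_nhds_inter.1 hU)
    obtain ⟨l, hl, hlr⟩ := exists_Ioc_subset_of_mem_nhds hr ⟨s, hst⟩
    obtain ⟨u, hu, hlu, hut⟩ := exists_mem_Ioo_of_rho_eq h hs hst (max_lt hl hst)
    refine ⟨u, hrU ⟨hlr ⟨(le_max_left _ _).trans_lt hlu, hut.le⟩, hu,
      ((le_max_right _ _).trans_lt hlu).le, hut.le⟩, ?_⟩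
    rw [h]
    exact hut.ne
  · rw [frequently_iff]
    intro U hU
    have hmem : t ∈ 𝕋 ∩ Icc s t := ⟨ht, hst.le, le_rfl⟩
    exact ⟨t, mem_of_mem_nhdsWithin hmem hU, h.ne'⟩

lemma frequently_ne_of_sigma_eq (hsup : ¬ BddAbove 𝕋) (h : sigma 𝕋 t = t) :
    ∃ᶠ u in 𝓝[𝕋 ∩ Ici t] t, u ≠ t := by
  obtain ⟨s, hs, hst⟩ := exists_mem_gt hsup t
  rw [frequently_iff]
  intro U hU
  obtain ⟨r, hr, hrU⟩ := (mem_nhdsWithin_iff_exists_mem_nhds_inter.1 hU)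
  obtain ⟨l, hl, hlr⟩ := exists_Ico_subset_of_mem_nhds hr ⟨s, hst⟩
  obtain ⟨u, hu, htu, hul⟩ := exists_mem_Ioo_of_sigma_eq h hs hst hl
  exact ⟨u, hrU ⟨hlr ⟨htu.le, hul⟩, hu, htu.le⟩, htu.ne'⟩

/-- This is what makes the nabla derivative unique: the defining inequality determines it only at
points `s ≠ ρ(t)`, and membership in `𝕋_κ` supplies such points arbitrarily close to `t`. -/
lemma frequently_ne_rho (hsup : ¬ BddAbove 𝕋) (ht : t ∈ kappa 𝕋) :
    ∃ᶠ u in 𝓝[𝕋] t, u ≠ rho 𝕋 t := by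
  by_cases hmin : IsLeast 𝕋 t
  · have h : sigma 𝕋 t = t := by
      by_contra h
      exact ht.2 ⟨hmin, lt_of_le_of_ne (le_sigma 𝕋 t) (Ne.symm h)⟩
    have hr : rho 𝕋 t = t := by
      rw [rho, if_neg]
      rintro ⟨u, hu, hut⟩
      exact absurd (hmin.2 hu) (not_le.2 hut)
    rw [hr]
    exact (frequently_ne_of_sigma_eq hsup h).filter_mono (nhdsWithin_mono _ inter_subset_left)
  · obtain ⟨s, hs, hst⟩ : ∃ s ∈ 𝕋, s < t := by
      by_contra! h
      exact hmin ⟨ht.1, h⟩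
    exact (frequently_ne_rho_left ht.1 hs hst).filter_mono (nhdsWithin_mono _ inter_subset_left)

/-- The excluded point is a right-scattered minimum, hence isolated, and every continuity statement
there is automatic. -/
lemma nhdsWithin_eq_pure (ht : t ∈ 𝕋) (hk : t ∉ kappa 𝕋) : 𝓝[𝕋] t = pure t := by
  have h : IsLeast 𝕋 t ∧ t < sigma 𝕋 t := by
    by_contra h
    exact hk ⟨ht, h⟩
  have hsub : 𝕋 = insert t (𝕋 ∩ Ioi t) := by
    refine subset_antisymm (fun u hu => ?_) (insert_subset ht inter_subset_left)
    exact (h.1.2 hu).eq_or_lt.elim (fun e => Or.inl e.symm) fun e => Or.inr ⟨hu, e⟩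
  rw [hsub, nhdsWithin_insert, nhdsWithin_Ioi_eq_bot h.2.ne', sup_bot_eq]

lemma eventually_mem_kappa (ht : t ∈ kappa 𝕋) : ∀ᶠ s in 𝓝[𝕋] t, s ∈ kappa 𝕋 := by
  by_cases h : ∃ u ∈ 𝕋, u < t
  · obtain ⟨u, hu, hut⟩ := h
    filter_upwards [self_mem_nhdsWithin, mem_nhdsWithin_of_mem_nhds (Ioi_mem_nhds hut)]
      with s hs hus using mem_kappa_of_lt hs hu hus
  · push Not at h
    filter_upwards [self_mem_nhdsWithin] with s hs
    rcases (h s hs).eq_or_lt with rfl | h'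
    · exact ht
    · exact mem_kappa_of_lt hs ht.1 h'

end Jumps

/-! ### Nabla derivative: algebra, product rule, uniqueness -/

section Deriv

variable {𝕋 : Set ℝ} {s t : ℝ} {F F' F'' : Type*} [NormedAddCommGroup F] [NormedSpace ℝ F]
  [NormedAddCommGroup F'] [NormedSpace ℝ F'] [NormedAddCommGroup F''] [NormedSpace ℝ F'']
  {f f₁ : ℝ → F} {d d₁ : F}

open Asymptotics

lemma hasNablaDerivAt_iff : HasNablaDerivAt 𝕋 f d t ↔
    (fun s => f (rho 𝕋 t) - f s - (rho 𝕋 t - s) • d) =o[𝓝[𝕋] t] fun s => rho 𝕋 t - s := by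
  simp only [HasNablaDerivAt, isLittleO_iff, Real.norm_eq_abs]

lemma HasNablaDerivAt.add (h : HasNablaDerivAt 𝕋 f d t) (h₁ : HasNablaDerivAt 𝕋 f₁ d₁ t) :
    HasNablaDerivAt 𝕋 (fun s => f s + f₁ s) (d + d₁) t := by
  rw [hasNablaDerivAt_iff] at *
  refine (h.add h₁).congr_left fun s => ?_
  rw [smul_add]
  abel

lemma HasNablaDerivAt.clm (h : HasNablaDerivAt 𝕋 f d t) (A : F →L[ℝ] F') :
    HasNablaDerivAt 𝕋 (fun s => A (f s)) (A d) t := by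
  rw [hasNablaDerivAt_iff] at *
  exact ((A.isBigO_comp _ _).trans_isLittleO h).congr_left fun s => by simp

lemma HasNablaDerivAt.const_smul (h : HasNablaDerivAt 𝕋 f d t) (c : ℝ) :
    HasNablaDerivAt 𝕋 (fun s => c • f s) (c • d) t :=
  h.clm (c • ContinuousLinearMap.id ℝ F)

lemma HasNablaDerivAt.neg (h : HasNablaDerivAt 𝕋 f d t) :
    HasNablaDerivAt 𝕋 (fun s => - f s) (- d) t :=
  h.clm (-ContinuousLinearMap.id ℝ F)

lemma HasNablaDerivAt.sub (h : HasNablaDerivAt 𝕋 f d t) (h₁ : HasNablaDerivAt 𝕋 f₁ d₁ t) :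
    HasNablaDerivAt 𝕋 (fun s => f s - f₁ s) (d - d₁) t := by
  simpa only [sub_eq_add_neg] using h.add h₁.neg

lemma hasNablaDerivAt_const (c : F) : HasNablaDerivAt 𝕋 (fun _ => c) 0 t := by
  rw [hasNablaDerivAt_iff]
  simp

lemma HasNablaDerivAt.congr (h : HasNablaDerivAt 𝕋 f d t) (he : ∀ᶠ s in 𝓝[𝕋] t, f s = f₁ s)
    (hr : f (rho 𝕋 t) = f₁ (rho 𝕋 t)) : HasNablaDerivAt 𝕋 f₁ d t := by
  rw [hasNablaDerivAt_iff] at *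
  refine h.congr' ?_ EventuallyEq.rfl
  filter_upwards [he] with s hs
  rw [hs, hr]

lemma HasNablaDerivAt.continuousWithinAt (h : HasNablaDerivAt 𝕋 f d t) (ht : t ∈ 𝕋) :
    ContinuousWithinAt f 𝕋 t := by
  rw [hasNablaDerivAt_iff] at h
  -- The filter `𝓝[𝕋] t` contains `t` itself, so the inequality may be evaluated at `s = t`; letting
  -- `ε → 0` makes it an identity.
  have h0 : f (rho 𝕋 t) - f t - (rho 𝕋 t - t) • d = 0 := by
    rw [← norm_le_zero_iff]
    refine le_of_forall_pos_le_add fun ε hε => ?_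
    have hε' : 0 < ε / (|rho 𝕋 t - t| + 1) := by positivity
    have := (h.def hε').self_of_nhdsWithin ht
    rw [zero_add]
    refine this.trans ?_
    rw [div_mul_eq_mul_div, div_le_iff₀ (by positivity), Real.norm_eq_abs]
    nlinarith
  have h1 : (fun s => rho 𝕋 t - s) =O[𝓝[𝕋] t] fun _ => (1 : ℝ) := by
    have : Tendsto (fun s => rho 𝕋 t - s) (𝓝[𝕋] t) (𝓝 (rho 𝕋 t - t)) :=
      (Continuous.tendsto (by fun_prop) t).mono_left nhdsWithin_le_nhds
    exact this.isBigO_one ℝ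
  have h2 := (isLittleO_one_iff ℝ).1 (h.trans_isBigO h1)
  have h3 : Tendsto (fun s => f (rho 𝕋 t) - (rho 𝕋 t - s) • d) (𝓝[𝕋] t)
      (𝓝 (f (rho 𝕋 t) - (rho 𝕋 t - t) • d)) :=
    (Continuous.tendsto (by fun_prop) t).mono_left nhdsWithin_le_nhds
  have h4 := h3.sub h2
  have h5 : f (rho 𝕋 t) - (rho 𝕋 t - t) • d - 0 = f t := by
    rw [sub_zero, ← sub_eq_zero, ← h0]
    abel
  rw [h5] at h4
  refine h4.congr fun s => ?_
  abel

/-- Evaluation of the defining inequality at `s = t` with `ε → 0`. At a left-dense point both sides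
are zero. -/
lemma HasNablaDerivAt.eq_of_rho_lt (h : HasNablaDerivAt 𝕋 f d t) (ht : t ∈ 𝕋) :
    f t - f (rho 𝕋 t) = (t - rho 𝕋 t) • d := by
  rw [← sub_eq_zero, ← norm_le_zero_iff]
  refine le_of_forall_pos_le_add fun ε hε => ?_
  have hε' : 0 < ε / (|rho 𝕋 t - t| + 1) := by positivity
  have := (h _ hε').self_of_nhdsWithin ht
  rw [zero_add, ← norm_neg]
  refine (le_of_eq ?_).trans (this.trans ?_)
  · congr 1
    module
  · rw [div_mul_eq_mul_div, div_le_iff₀ (by positivity)]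
    nlinarith

/-- Product rule `(f g)^∇ = f^∇ g^ρ + f g^∇`, for a bilinear product. -/
lemma HasNablaDerivAt.bilin (B : F →L[ℝ] F' →L[ℝ] F'') {g : ℝ → F'} {e : F'}
    (h : HasNablaDerivAt 𝕋 f d t) (hg : HasNablaDerivAt 𝕋 g e t) (ht : t ∈ 𝕋) :
    HasNablaDerivAt 𝕋 (fun s => B (f s) (g s)) (B d (g (rho 𝕋 t)) + B (f t) e) t := by
  have hc := h.continuousWithinAt ht
  rw [hasNablaDerivAt_iff] at *
  -- The error in the product rule splits into the error of `f` times `g^ρ`, then `f(s)` times the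
  -- error of `g`, and a term `(ρ(t) - s) (f(s) - f(t)) e` that is small by continuity of `f`.
  have e1 : (fun s => B (f (rho 𝕋 t) - f s - (rho 𝕋 t - s) • d) (g (rho 𝕋 t)))
      =o[𝓝[𝕋] t] fun s => rho 𝕋 t - s :=
    ((B.flip (g (rho 𝕋 t))).isBigO_comp _ _).trans_isLittleO h
  have hbd : (fun s => B (f s)) =O[𝓝[𝕋] t] fun _ => (1 : ℝ) :=
    Tendsto.isBigO_one ℝ ((B.continuous.tendsto _).comp hc)
  have e2 : (fun s => B (f s) (g (rho 𝕋 t) - g s - (rho 𝕋 t - s) • e))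
      =o[𝓝[𝕋] t] fun s => rho 𝕋 t - s := by
    refine IsBigO.trans_isLittleO (isBigO_of_le (g := fun s => ‖B (f s)‖ *
      ‖g (rho 𝕋 t) - g s - (rho 𝕋 t - s) • e‖) _ fun s => ?_) ?_
    · rw [norm_mul, norm_norm, norm_norm]
      exact (B (f s)).le_opNorm _
    · exact (hbd.norm_left.mul_isLittleO hg.norm_left).congr_right fun s => one_mul _
  have e3 : (fun s => (rho 𝕋 t - s) • B (f s - f t) e) =o[𝓝[𝕋] t] fun s => rho 𝕋 t - s := by
    have h0 : Tendsto (fun s => B (f s - f t) e) (𝓝[𝕋] t) (𝓝 0) := by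
      have : Tendsto (fun s => f s - f t) (𝓝[𝕋] t) (𝓝 0) := by
        simpa using Tendsto.sub hc (tendsto_const_nhds (x := f t))
      simpa [Function.comp_def] using ((B.flip e).continuous.tendsto 0).comp this
    exact ((isBigO_refl (fun s => rho 𝕋 t - s) _).smul_isLittleO
      ((isLittleO_one_iff ℝ).2 h0)).congr_right fun s => by simp
  refine ((e1.add e2).add e3).congr_left fun s => ?_
  simp only [map_sub, map_smul, sub_apply, smul_apply,
    smul_sub, smul_add]
  abel

/-- Uniqueness of the nabla derivative along a subset accumulating at the point. -/
lemma HasNablaDerivAt.unique_of_eqOn {S : Set ℝ} (hS : S ⊆ 𝕋)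
    (hfr : ∃ᶠ u in 𝓝[S] t, u ≠ rho 𝕋 t) (h : HasNablaDerivAt 𝕋 f d t)
    (h₁ : HasNablaDerivAt 𝕋 f₁ d₁ t) (he : ∀ᶠ s in 𝓝[S] t, f s = f₁ s)
    (hr : f (rho 𝕋 t) = f₁ (rho 𝕋 t)) : d = d₁ := by
  rw [← sub_eq_zero, ← norm_le_zero_iff]
  refine le_of_forall_pos_le_add fun ε hε => ?_
  have hle := nhdsWithin_mono t hS
  obtain ⟨s, hs, ⟨⟨hs1, hs2⟩, hs3⟩⟩ := (hfr.and_eventually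
    (((h _ (half_pos hε)).filter_mono hle).and ((h₁ _ (half_pos hε)).filter_mono hle)
      |>.and he)).exists
  have hpos : 0 < |rho 𝕋 t - s| := abs_pos.2 (sub_ne_zero.2 hs.symm)
  rw [zero_add, ← mul_le_mul_iff_right₀ hpos, ← Real.norm_eq_abs, ← norm_smul]
  calc ‖(rho 𝕋 t - s) • (d - d₁)‖
      = ‖(f₁ (rho 𝕋 t) - f₁ s - (rho 𝕋 t - s) • d₁)
          - (f (rho 𝕋 t) - f s - (rho 𝕋 t - s) • d)‖ := by
        rw [hs3, hr]
        congr 1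
        module
    _ ≤ ε / 2 * |rho 𝕋 t - s| + ε / 2 * |rho 𝕋 t - s| :=
        (norm_sub_le _ _).trans (add_le_add hs2 hs1)
    _ = ‖rho 𝕋 t - s‖ * ε := by rw [Real.norm_eq_abs]; ring

lemma HasNablaDerivAt.unique (hsup : ¬ BddAbove 𝕋) (ht : t ∈ kappa 𝕋)
    (h : HasNablaDerivAt 𝕋 f d t) (h₁ : HasNablaDerivAt 𝕋 f d₁ t) : d = d₁ :=
  h.unique_of_eqOn subset_rfl (frequently_ne_rho hsup ht) h₁ (by simp) rfl

lemma NablaDifferentiableAt.hasNablaDerivAt (h : NablaDifferentiableAt 𝕋 f t) :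
    HasNablaDerivAt 𝕋 f (nablaDeriv 𝕋 f t) t := by
  rw [nablaDeriv, dif_pos h]
  exact h.2.choose_spec

lemma HasNablaDerivAt.nablaDeriv_eq (hsup : ¬ BddAbove 𝕋) (ht : t ∈ kappa 𝕋)
    (h : HasNablaDerivAt 𝕋 f d t) : nablaDeriv 𝕋 f t = d :=
  (NablaDifferentiableAt.hasNablaDerivAt ⟨ht, d, h⟩).unique hsup ht h

lemma nablaDeriv_of_notMem (ht : t ∉ kappa 𝕋) : nablaDeriv 𝕋 f t = 0 := by
  rw [nablaDeriv, dif_neg]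
  exact fun h => ht h.1

end Deriv

/-! ### Mean value inequalities and independence of the antiderivative -/

section MeanValue

variable {𝕋 : Set ℝ} {F : Type*} [NormedAddCommGroup F] [NormedSpace ℝ F]

lemma continuousOn_of_hasNablaDerivAt {f G : ℝ → F}
    (hG : ∀ t ∈ kappa 𝕋, HasNablaDerivAt 𝕋 G (f t) t) : ContinuousOn G 𝕋 := by
  intro t ht
  by_cases hk : t ∈ kappa 𝕋
  · exact (hG t hk).continuousWithinAt ht
  · rw [ContinuousWithinAt, nhdsWithin_eq_pure ht hk]
    exact tendsto_pure_nhds _ _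

/-- One-sided mean value inequality. -/
lemma sub_le_of_nablaDeriv_le (h𝕋 : IsClosed 𝕋) {f G : ℝ → ℝ}
    (hG : ∀ t ∈ kappa 𝕋, HasNablaDerivAt 𝕋 G (f t) t) {a b C : ℝ} (ha : a ∈ 𝕋) (hb : b ∈ 𝕋)
    (hab : a ≤ b) (hC : ∀ t ∈ 𝕋, a < t → t ≤ b → f t ≤ C) : G b - G a ≤ C * (b - a) := by
  have key : ∀ C' > C, G b - G a ≤ C' * (b - a) := by
    intro C' hC'
    -- `S` collects the points from which the bound holds up to `b`. Its infimum `m` lies in `S`,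
    -- and if `m > a` it can be moved further left: by the derivative estimate with slack `C' - C`
    -- at a left-dense point, by the exact jump relation at a left-scattered one.
    let S : Set ℝ := {t ∈ 𝕋 ∩ Icc a b | G b - G t ≤ C' * (b - t)}
    have hcpt : IsCompact (𝕋 ∩ Icc a b) := isCompact_Icc.inter_left h𝕋
    have hcG : ContinuousOn G (𝕋 ∩ Icc a b) :=
      (continuousOn_of_hasNablaDerivAt hG).mono inter_subset_left
    have hSc : IsClosed S :=
      hcpt.isClosed.isClosed_le (continuousOn_const.sub hcG) (by fun_prop)
    have hbS : b ∈ S := ⟨⟨hb, hab, le_rfl⟩, by simp⟩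
    have hbdd : BddBelow S := ⟨a, fun t ht => ht.1.2.1⟩
    have hm : sInf S ∈ S := hSc.csInf_mem ⟨b, hbS⟩ hbdd
    set m := sInf S with hmdef
    have hmin : ∀ s ∈ S, m ≤ s := fun s hs => csInf_le hbdd hs
    rcases hm.1.2.1.eq_or_lt with h | ham
    · rw [h]; exact hm.2
    exfalso
    have hfm : f m ≤ C := hC m hm.1.1 ham hm.1.2.2
    have hd := hG m (mem_kappa_of_lt hm.1.1 ha ham)
    rcases rho_eq_or_lt 𝕋 m with h | h
    · have hev := (hd (C' - C) (by linarith)).filter_mono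
        (nhdsWithin_mono m (inter_subset_left : 𝕋 ∩ Icc a m ⊆ 𝕋))
      obtain ⟨s, hs1, hs2, hs3⟩ := ((frequently_ne_rho_left hm.1.1 ha ham).and_eventually
        (hev.and self_mem_nhdsWithin)).exists
      rw [h] at hs1 hs2
      have hsm : s < m := lt_of_le_of_ne hs3.2.2 hs1
      have : s ∈ S := by
        refine ⟨⟨hs3.1, hs3.2.1, hsm.le.trans hm.1.2.2⟩, ?_⟩
        rw [abs_of_pos (sub_pos.2 hsm), Real.norm_eq_abs, smul_eq_mul] at hs2
        have := (abs_le.1 hs2).2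
        have := hm.2
        nlinarith
      exact absurd (hmin s this) (not_le.2 hsm)
    · have : rho 𝕋 m ∈ S := by
        have har := le_rho ha ham
        refine ⟨⟨rho_mem h𝕋 hm.1.1, har, h.le.trans hm.1.2.2⟩, ?_⟩
        have h1 := hd.eq_of_rho_lt hm.1.1
        rw [smul_eq_mul] at h1
        have := hm.2
        nlinarith
      exact absurd (hmin _ this) (not_le.2 h)
  refine le_of_forall_pos_le_add fun ε hε => ?_
  have h1 := key (C + ε / (b - a + 1)) (by have : 0 < b - a + 1 := by linarith
                                           linarith [div_pos hε this])
  have h2 : ε / (b - a + 1) * (b - a) ≤ ε := by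
    rw [div_mul_eq_mul_div, div_le_iff₀ (by linarith)]
    nlinarith
  linarith

/-- Mean value inequality. -/
lemma norm_sub_le_of_norm_nablaDeriv_le (h𝕋 : IsClosed 𝕋) {f G : ℝ → F}
    (hG : ∀ t ∈ kappa 𝕋, HasNablaDerivAt 𝕋 G (f t) t) {a b C : ℝ} (ha : a ∈ 𝕋) (hb : b ∈ 𝕋)
    (hab : a ≤ b) (hC : ∀ t ∈ 𝕋, a < t → t ≤ b → ‖f t‖ ≤ C) : ‖G b - G a‖ ≤ C * (b - a) := by
  -- A norming functional reduces the vector case to the scalar one.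
  obtain ⟨φ, hφ, hφ'⟩ := exists_dual_vector'' ℝ (G b - G a)
  have h := sub_le_of_nablaDeriv_le h𝕋 (f := fun t => φ (f t)) (G := fun t => φ (G t))
    (fun t ht => (hG t ht).clm φ) ha hb hab fun t ht h1 h2 =>
      (le_abs_self _).trans (((φ.le_of_opNorm_le hφ _).trans_eq (one_mul _)).trans (hC t ht h1 h2))
  rwa [← map_sub, hφ'] at h

lemma eq_of_nablaDeriv_eq_zero (h𝕋 : IsClosed 𝕋) {f G : ℝ → F}
    (hG : ∀ t ∈ kappa 𝕋, HasNablaDerivAt 𝕋 G (f t) t) {a b : ℝ} (ha : a ∈ 𝕋) (hb : b ∈ 𝕋)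
    (hab : a ≤ b) (hf : ∀ t ∈ 𝕋, a < t → t ≤ b → f t = 0) : G b = G a := by
  have := norm_sub_le_of_norm_nablaDeriv_le h𝕋 hG (C := 0) ha hb hab
    fun t ht h1 h2 => by simp [hf t ht h1 h2]
  rwa [zero_mul, norm_le_zero_iff, sub_eq_zero] at this

/-- Two functions whose nabla derivatives agree on `(a, b]` have the same increment. -/
lemma sub_eq_sub_of_nablaDeriv_eq (h𝕋 : IsClosed 𝕋) {f G f₁ G₁ : ℝ → F}
    (hG : ∀ t ∈ kappa 𝕋, HasNablaDerivAt 𝕋 G (f t) t)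
    (hG₁ : ∀ t ∈ kappa 𝕋, HasNablaDerivAt 𝕋 G₁ (f₁ t) t) {a b : ℝ} (ha : a ∈ 𝕋) (hb : b ∈ 𝕋)
    (hab : a ≤ b) (hf : ∀ t ∈ 𝕋, a < t → t ≤ b → f t = f₁ t) : G b - G a = G₁ b - G₁ a := by
  have := eq_of_nablaDeriv_eq_zero h𝕋 (f := fun t => f t - f₁ t) (G := fun t => G t - G₁ t)
    (fun t ht => (hG t ht).sub (hG₁ t ht)) ha hb hab fun t ht h1 h2 => sub_eq_zero.2 (hf t ht h1 h2)
  rw [sub_eq_sub_iff_sub_eq_sub]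
  simpa using this

/-- A nonnegative function with vanishing integral over `[a, b]` vanishes on `(a, b]`. -/
lemma eq_zero_of_nonneg_of_antideriv_eq (h𝕋 : IsClosed 𝕋) {f G : ℝ → ℝ}
    (hG : ∀ t ∈ kappa 𝕋, HasNablaDerivAt 𝕋 G (f t) t) {a b : ℝ} (ha : a ∈ 𝕋) (hb : b ∈ 𝕋)
    (hf : ∀ t ∈ 𝕋, 0 ≤ f t) (h : G b = G a) {t : ℝ} (ht : t ∈ 𝕋) (hat : a < t) (htb : t ≤ b) :
    f t = 0 := by
  have mono : ∀ u ∈ 𝕋, ∀ v ∈ 𝕋, u ≤ v → G u ≤ G v := by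
    intro u hu v hv huv
    have := sub_le_of_nablaDeriv_le h𝕋 (f := fun t => - f t) (G := fun t => - G t)
      (fun t ht => (hG t ht).neg) (C := 0) hu hv huv fun s hs _ _ => by simpa using hf s hs
    linarith
  have hconst : ∀ u ∈ 𝕋, a ≤ u → u ≤ b → G u = G b := fun u hu h1 h2 =>
    le_antisymm (mono u hu b hb h2) (h ▸ mono a ha u hu h1)
  -- `G` is monotone with equal end values, hence constant on `[a, b]`. Comparing derivatives only
  -- along points to the left of `t` also covers `t = b`.
  refine (hG t (mem_kappa_of_lt ht ha hat)).unique_of_eqOn (S := 𝕋 ∩ Icc a t) inter_subset_left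
    (frequently_ne_rho_left ht ha hat) (hasNablaDerivAt_const (G b)) ?_ ?_
  · filter_upwards [self_mem_nhdsWithin] with s hs
    exact hconst s hs.1 hs.2.1 (hs.2.2.trans htb)
  · exact hconst _ (rho_mem h𝕋 ht) (le_rho ha hat) ((rho_le 𝕋 t).trans htb)

/-- Two antiderivatives of the same function have equal increments, so the one chosen in the
definition of the integral is immaterial. -/
lemma nablaIntegral_eq (h𝕋 : IsClosed 𝕋) {f G : ℝ → ℝ} (hG : IsNablaAntideriv 𝕋 f G) {a b : ℝ}
    (ha : a ∈ 𝕋) (hb : b ∈ 𝕋) : nablaIntegral 𝕋 f a b = G b - G a := by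
  have hex : ∃ G : ℝ → ℝ, IsNablaAntideriv 𝕋 f G := ⟨G, hG⟩
  rw [nablaIntegral, dif_pos hex]
  have hc := hex.choose_spec
  rcases le_total a b with h | h
  · exact sub_eq_sub_of_nablaDeriv_eq h𝕋 hc hG ha hb h fun _ _ _ _ => rfl
  · have := sub_eq_sub_of_nablaDeriv_eq h𝕋 hc hG hb ha h fun _ _ _ _ => rfl
    linarith

end MeanValue

/-! ### Ld-continuous functions: closure properties and uniform bounds on compact sets -/

section LdContinuous

variable {𝕋 : Set ℝ} {F F' Y : Type*} [NormedAddCommGroup F] [NormedAddCommGroup F']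
  [NormedAddCommGroup Y]

lemma LdContinuous.continuous_comp {f : ℝ → F} (hf : LdContinuous 𝕋 f) {φ : F → F'}
    (hφ : Continuous φ) : LdContinuous 𝕋 fun t => φ (f t) := fun t ht =>
  ⟨fun h => hφ.continuousAt.comp_continuousWithinAt ((hf t ht).1 h), fun h =>
    let ⟨l, hl⟩ := (hf t ht).2 h
    ⟨φ l, (hφ.tendsto l).comp hl⟩⟩

lemma LdContinuous.prodMk {f : ℝ → F} {f' : ℝ → F'} (hf : LdContinuous 𝕋 f)
    (hf' : LdContinuous 𝕋 f') : LdContinuous 𝕋 fun t => (f t, f' t) := fun t ht =>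
  ⟨fun h => ((hf t ht).1 h).prodMk ((hf' t ht).1 h), fun h =>
    let ⟨l, hl⟩ := (hf t ht).2 h
    let ⟨l', hl'⟩ := (hf' t ht).2 h
    ⟨(l, l'), hl.prodMk_nhds hl'⟩⟩

lemma LdContinuous.add {f g : ℝ → F} (hf : LdContinuous 𝕋 f) (hg : LdContinuous 𝕋 g) :
    LdContinuous 𝕋 fun t => f t + g t :=
  (hf.prodMk hg).continuous_comp continuous_add

lemma LdContinuous.sub {f g : ℝ → F} (hf : LdContinuous 𝕋 f) (hg : LdContinuous 𝕋 g) :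
    LdContinuous 𝕋 fun t => f t - g t :=
  (hf.prodMk hg).continuous_comp continuous_sub

lemma LdContinuous.smul [NormedSpace ℝ F] {f : ℝ → ℝ} {g : ℝ → F} (hf : LdContinuous 𝕋 f) (hg : LdContinuous 𝕋 g) :
    LdContinuous 𝕋 fun t => f t • g t :=
  (hf.prodMk hg).continuous_comp continuous_smul

lemma LdContinuous.inner {E : Type*} [NormedAddCommGroup E] [InnerProductSpace ℝ E] {f g : ℝ → E}
    (hf : LdContinuous 𝕋 f) (hg : LdContinuous 𝕋 g) :
    LdContinuous 𝕋 fun t => inner ℝ (f t) (g t) :=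
  (hf.prodMk hg).continuous_comp (φ := fun q : E × E => Inner.inner ℝ q.1 q.2) continuous_inner

lemma LdContinuous.congr {f g : ℝ → F} (hf : LdContinuous 𝕋 f) (h : EqOn g f 𝕋) :
    LdContinuous 𝕋 g := fun t ht =>
  ⟨fun h' => ((hf t ht).1 h').congr h (h ht), fun h' =>
    let ⟨l, hl⟩ := (hf t ht).2 h'
    ⟨l, hl.congr' (by filter_upwards [self_mem_nhdsWithin] with s hs using (h hs.1).symm)⟩⟩

lemma LdContinuous.of_continuousOn {f : ℝ → F} (hf : ContinuousOn f 𝕋) : LdContinuous 𝕋 f :=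
  fun t ht => ⟨fun _ => hf t ht, fun _ => ⟨f t, (hf t ht).mono inter_subset_left⟩⟩

lemma tendsto_rho_of_rho_eq {t : ℝ} (ht : t ∈ 𝕋) (h : rho 𝕋 t = t) :
    Tendsto (rho 𝕋) (𝓝[𝕋] t) (𝓝 t) := by
  rw [tendsto_order]
  constructor
  · intro r hr
    by_cases hmin : ∃ s ∈ 𝕋, s < t
    · obtain ⟨s, hs, hst⟩ := hmin
      obtain ⟨u, hu, hru, hut⟩ := exists_mem_Ioo_of_rho_eq h hs hst hr
      filter_upwards [mem_nhdsWithin_of_mem_nhds (Ioi_mem_nhds hut)] with v hv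
      exact hru.trans_le (le_rho hu hv)
    · push Not at hmin
      filter_upwards [self_mem_nhdsWithin] with v hv
      rcases (hmin v hv).eq_or_lt with rfl | h'
      · rwa [h]
      · exact hr.trans_le (le_rho ht h')
  · intro r hr
    filter_upwards [mem_nhdsWithin_of_mem_nhds (Iio_mem_nhds hr)] with v hv
    exact (rho_le 𝕋 v).trans_lt hv

lemma tendsto_rho_right {t : ℝ} (ht : t ∈ 𝕋) : Tendsto (rho 𝕋) (𝓝[𝕋 ∩ Ioi t] t) (𝓝 t) := by
  refine tendsto_of_tendsto_of_tendsto_of_le_of_le' tendsto_const_nhds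
    (tendsto_id.mono_left nhdsWithin_le_nhds) ?_ (Eventually.of_forall fun s => rho_le 𝕋 s)
  filter_upwards [self_mem_nhdsWithin] with v hv using le_rho ht hv.2

/-- For `s > t` one has `t ≤ ρ(s) ≤ s`, so the right limit of `f ∘ ρ` at a right-dense point is
`f(t)`, even when `ρ(t) < t`. -/
lemma LdContinuous.comp_rho (h𝕋 : IsClosed 𝕋) {f : ℝ → F} (hf : ContinuousOn f 𝕋) :
    LdContinuous 𝕋 fun t => f (rho 𝕋 t) := by
  intro t ht
  constructor
  · intro h
    have h1 : Tendsto (rho 𝕋) (𝓝[𝕋] t) (𝓝[𝕋] t) :=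
      tendsto_nhdsWithin_iff.2 ⟨tendsto_rho_of_rho_eq ht h,
        by filter_upwards [self_mem_nhdsWithin] with s hs using rho_mem h𝕋 hs⟩
    rw [ContinuousWithinAt, h]
    exact (hf t ht).tendsto.comp h1
  · intro _
    have h1 : Tendsto (rho 𝕋) (𝓝[𝕋 ∩ Ioi t] t) (𝓝[𝕋] t) :=
      tendsto_nhdsWithin_iff.2 ⟨tendsto_rho_right ht,
        by filter_upwards [self_mem_nhdsWithin] with s hs using rho_mem h𝕋 hs.1⟩
    exact ⟨f t, (hf t ht).tendsto.comp h1⟩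

/-- At a right-dense point the joint limit is taken at the right limit of `y`, which may differ from
`y(t)`. -/
lemma JointlyLdContinuous.comp {f : ℝ → Y → F} (hf : JointlyLdContinuous 𝕋 f) {y : ℝ → Y}
    (hy : LdContinuous 𝕋 y) : LdContinuous 𝕋 fun t => f t (y t) := by
  intro t ht
  constructor
  · intro h
    have h1 := (hf t ht (y t)).1 h
    rw [ContinuousWithinAt, nhdsWithin_prod_eq, nhdsWithin_univ] at h1
    exact h1.comp (tendsto_id.prodMk ((hy t ht).1 h))
  · intro h
    obtain ⟨l, hl⟩ := (hy t ht).2 h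
    obtain ⟨m, hm⟩ := (hf t ht l).2 h
    exact ⟨m, hm.comp (tendsto_id.prodMk hl)⟩

lemma LdContinuous.eventually_norm_le {f : ℝ → F} (hf : LdContinuous 𝕋 f) {t : ℝ} (ht : t ∈ 𝕋) :
    ∃ C, ∀ᶠ s in 𝓝[𝕋] t, ‖f s‖ ≤ C := by
  rcases rho_eq_or_lt 𝕋 t with h | h
  · exact ⟨‖f t‖ + 1, (((hf t ht).1 h).norm.eventually (ge_mem_nhds (lt_add_one _)))⟩
  · rw [nhdsWithin_eq_of_rho_lt ht h]
    by_cases h' : sigma 𝕋 t = t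
    · obtain ⟨l, hl⟩ := (hf t ht).2 h'
      refine ⟨max ‖f t‖ (‖l‖ + 1), eventually_sup.2 ⟨eventually_pure.2 (le_max_left _ _), ?_⟩⟩
      filter_upwards [hl.norm.eventually (ge_mem_nhds (lt_add_one _))] with s hs
      exact hs.trans (le_max_right _ _)
    · rw [nhdsWithin_Ioi_eq_bot h', sup_bot_eq]
      exact ⟨‖f t‖, le_refl ‖f t‖⟩

lemma LdContinuous.exists_norm_le (h𝕋 : IsClosed 𝕋) {f : ℝ → F} (hf : LdContinuous 𝕋 f)
    (a b : ℝ) : ∃ C, 0 ≤ C ∧ ∀ t ∈ 𝕋 ∩ Icc a b, ‖f t‖ ≤ C := by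
  have hcpt : IsCompact (𝕋 ∩ Icc a b) := isCompact_Icc.inter_left h𝕋
  refine hcpt.induction_on (p := fun S => ∃ C, 0 ≤ C ∧ ∀ t ∈ S, ‖f t‖ ≤ C) ⟨0, le_rfl, by simp⟩
    (fun s t hst ⟨C, h0, h⟩ => ⟨C, h0, fun u hu => h u (hst hu)⟩)
    (fun s t ⟨C, h0, h⟩ ⟨D, _, h'⟩ => ⟨max C D, h0.trans (le_max_left _ _), ?_⟩)
    (fun t ht => ?_)
  · rintro u (hu | hu)
    · exact (h u hu).trans (le_max_left _ _)
    · exact (h' u hu).trans (le_max_right _ _)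
  · obtain ⟨C, hC⟩ := hf.eventually_norm_le ht.1
    exact ⟨{s | ‖f s‖ ≤ C}, hC.filter_mono (nhdsWithin_mono t inter_subset_left), max C 0,
      le_max_right _ _, fun u hu => le_trans hu (le_max_left _ _)⟩

/-- Local form of a modulus of continuity in `y` uniform in `t`. At a left-scattered point the
values near `t` may approach a limit other than the value at `t`, but on each of the two pieces the
difference tends to zero. -/
lemma JointlyLdContinuous.tendsto_sub {f : ℝ → Y → F} (hf : JointlyLdContinuous 𝕋 f)
    (hfc : ∀ t ∈ 𝕋, Continuous (f t)) {y : ℝ → Y} (hy : LdContinuous 𝕋 y) {t : ℝ} (ht : t ∈ 𝕋) :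
    Tendsto (fun q : ℝ × Y => f q.1 (y q.1 + q.2) - f q.1 (y q.1)) (𝓝[𝕋] t ×ˢ 𝓝 0) (𝓝 0) := by
  have main : ∀ (l : Filter ℝ) (y₀ : Y) (m : F), Tendsto y l (𝓝 y₀) →
      Tendsto (fun q : ℝ × Y => f q.1 q.2) (l ×ˢ 𝓝 y₀) (𝓝 m) →
      Tendsto (fun q : ℝ × Y => f q.1 (y q.1 + q.2) - f q.1 (y q.1)) (l ×ˢ 𝓝 0) (𝓝 0) := by
    intro l y₀ m hl hm
    have h1 : Tendsto (fun q : ℝ × Y => y q.1) (l ×ˢ 𝓝 0) (𝓝 y₀) := hl.comp tendsto_fst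
    have h2 : Tendsto (fun q : ℝ × Y => y q.1 + q.2) (l ×ˢ 𝓝 0) (𝓝 y₀) := by
      simpa using h1.add (tendsto_snd (f := l) (g := 𝓝 (0 : Y)))
    have := (hm.comp (tendsto_fst.prodMk h2)).sub (hm.comp (tendsto_fst.prodMk h1))
    simpa [Function.comp_def] using this
  rcases rho_eq_or_lt 𝕋 t with h | h
  · have h1 := (hf t ht (y t)).1 h
    rw [ContinuousWithinAt, nhdsWithin_prod_eq, nhdsWithin_univ] at h1
    exact main _ _ _ ((hy t ht).1 h) h1
  · rw [nhdsWithin_eq_of_rho_lt ht h, sup_prod, tendsto_sup]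
    refine ⟨main _ (y t) (f t (y t)) (tendsto_pure_nhds _ _) ?_, ?_⟩
    · rw [pure_prod, tendsto_map'_iff]
      exact (hfc t ht).tendsto _
    · by_cases h' : sigma 𝕋 t = t
      · obtain ⟨l, hl⟩ := (hy t ht).2 h'
        obtain ⟨m, hm⟩ := (hf t ht l).2 h'
        exact main _ _ _ hl hm
      · rw [nhdsWithin_Ioi_eq_bot h', bot_prod]
        exact tendsto_bot

lemma JointlyLdContinuous.exists_norm_sub_lt (h𝕋 : IsClosed 𝕋) {f : ℝ → Y → F}
    (hf : JointlyLdContinuous 𝕋 f) (hfc : ∀ t ∈ 𝕋, Continuous (f t)) {y : ℝ → Y}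
    (hy : LdContinuous 𝕋 y) (a b : ℝ) {η : ℝ} (hη : 0 < η) :
    ∃ δ > 0, ∀ t ∈ 𝕋 ∩ Icc a b, ∀ h : Y, ‖h‖ < δ → ‖f t (y t + h) - f t (y t)‖ < η := by
  have hcpt : IsCompact (𝕋 ∩ Icc a b) := isCompact_Icc.inter_left h𝕋
  refine hcpt.induction_on (p := fun S => ∃ δ > 0, ∀ t ∈ S, ∀ h : Y, ‖h‖ < δ →
      ‖f t (y t + h) - f t (y t)‖ < η) ⟨1, one_pos, by simp⟩
    (fun s t hst ⟨δ, h0, h⟩ => ⟨δ, h0, fun u hu => h u (hst hu)⟩)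
    (fun s t ⟨δ, h0, h⟩ ⟨δ', h0', h'⟩ => ⟨min δ δ', lt_min h0 h0', ?_⟩)
    (fun t ht => ?_)
  · rintro u (hu | hu) v hv
    · exact h u hu v (hv.trans_le (min_le_left _ _))
    · exact h' u hu v (hv.trans_le (min_le_right _ _))
  · have h1 := (hf.tendsto_sub hfc hy ht.1).eventually (Metric.ball_mem_nhds 0 hη)
    obtain ⟨pa, hpa, pb, hpb, hp⟩ := eventually_prod_iff.1 h1
    obtain ⟨δ, hδ, hδ'⟩ := Metric.eventually_nhds_iff_ball.1 hpb
    exact ⟨{s | pa s}, hpa.filter_mono (nhdsWithin_mono t inter_subset_left), δ, hδ,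
      fun u hu h hh => by simpa using hp hu (hδ' h (by simpa using hh))⟩

end LdContinuous

/-! ### Existence of antiderivatives of ld-continuous functions -/

section Antiderivative

variable {𝕋 : Set ℝ} {F : Type*} [NormedAddCommGroup F]

/-- The least point of the time scale which is at least `s`. -/
noncomputable def ceilPt (𝕋 : Set ℝ) (s : ℝ) : ℝ := sInf (𝕋 ∩ Ici s)

lemma ceilPt_mem (h𝕋 : IsClosed 𝕋) (hsup : ¬ BddAbove 𝕋) (s : ℝ) :
    ceilPt 𝕋 s ∈ 𝕋 ∩ Ici s := by
  obtain ⟨u, hu, hsu⟩ := exists_mem_gt hsup s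
  exact (h𝕋.inter isClosed_Ici).csInf_mem ⟨u, hu, hsu.le⟩ ⟨s, fun v hv => hv.2⟩

lemma ceilPt_le {s t : ℝ} (ht : t ∈ 𝕋) (h : s ≤ t) : ceilPt 𝕋 s ≤ t :=
  csInf_le ⟨s, fun _ hv => hv.2⟩ ⟨ht, h⟩

/-- Either `𝕋` has a gap just to the left of `s`, where the ceiling is constant, or `s` is a
left-dense point of `𝕋` and continuity of `f` there applies. -/
lemma LdContinuous.leftContinuous_ceilPt (h𝕋 : IsClosed 𝕋) (hsup : ¬ BddAbove 𝕋) {f : ℝ → F}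
    (hf : LdContinuous 𝕋 f) (s : ℝ) :
    Tendsto (fun u => f (ceilPt 𝕋 u)) (𝓝[<] s) (𝓝 (f (ceilPt 𝕋 s))) := by
  by_cases h : ∃ r < s, ∀ u ∈ 𝕋, r < u → s ≤ u
  · obtain ⟨r, hr, h⟩ := h
    refine tendsto_const_nhds.congr' ?_
    filter_upwards [Ioo_mem_nhdsLT hr] with u hu
    have h1 := ceilPt_mem h𝕋 hsup u
    have h2 := ceilPt_mem h𝕋 hsup s
    have : ceilPt 𝕋 u = ceilPt 𝕋 s := le_antisymm (ceilPt_le h2.1 (hu.2.le.trans h2.2))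
      (ceilPt_le h1.1 (h _ h1.1 (hu.1.trans_le h1.2)))
    rw [this]
  · push Not at h
    have hs : s ∈ 𝕋 := by
      refine h𝕋.closure_subset (Metric.mem_closure_iff.2 fun ε hε => ?_)
      obtain ⟨u, hu, h1, h2⟩ := h (s - ε) (by linarith)
      exact ⟨u, hu, by rw [Real.dist_eq, abs_lt]; constructor <;> linarith⟩
    have hcs : ceilPt 𝕋 s = s := le_antisymm (ceilPt_le hs le_rfl) (ceilPt_mem h𝕋 hsup s).2
    have hr : rho 𝕋 s = s := by
      rcases rho_eq_or_lt 𝕋 s with h' | h'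
      · exact h'
      · obtain ⟨u, hu, h1, h2⟩ := h _ h'
        exact absurd (le_rho hu h2) (not_le.2 h1)
    rw [hcs]
    refine ((hf s hs).1 hr).tendsto.comp (tendsto_nhdsWithin_iff.2 ⟨?_,
      Eventually.of_forall fun u => (ceilPt_mem h𝕋 hsup u).1⟩)
    refine tendsto_of_tendsto_of_tendsto_of_le_of_le' (tendsto_id.mono_left nhdsWithin_le_nhds)
      tendsto_const_nhds (Eventually.of_forall fun u => (ceilPt_mem h𝕋 hsup u).2) ?_
    filter_upwards [self_mem_nhdsWithin] with u hu using ceilPt_le hs (le_of_lt hu)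

/-- A left-continuous function on the line is strongly measurable. -/
lemma stronglyMeasurable_of_leftContinuous {f : ℝ → F}
    (hf : ∀ s, Tendsto f (𝓝[<] s) (𝓝 (f s))) : MeasureTheory.StronglyMeasurable f := by
  -- `r n s` is the largest multiple of `1 / (n + 1)` strictly below `s`; `f ∘ r n` factors through
  -- an integer-valued function.
  let r : ℕ → ℝ → ℝ := fun n s => ((⌈((n : ℝ) + 1) * s⌉ - 1 : ℤ) : ℝ) / ((n : ℝ) + 1)
  refine stronglyMeasurable_of_tendsto (f := fun n s => f (r n s)) atTop (fun n => ?_)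
    (tendsto_pi_nhds.2 fun s => (hf s).comp (tendsto_nhdsWithin_iff.2 ⟨?_, ?_⟩))
  · have h1 : MeasureTheory.StronglyMeasurable
        fun k : ℤ => f (((k - 1 : ℤ) : ℝ) / ((n : ℝ) + 1)) := .of_discrete
    exact h1.comp_measurable (g := fun s : ℝ => ⌈((n : ℝ) + 1) * s⌉)
      (Int.measurable_ceil.comp (measurable_const_mul _))
  · have hlim : Tendsto (fun n : ℕ => s - 1 / ((n : ℝ) + 1)) atTop (𝓝 s) := by
      simpa using tendsto_const_nhds.sub (tendsto_one_div_add_atTop_nhds_zero_nat (𝕜 := ℝ))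
    refine tendsto_of_tendsto_of_tendsto_of_le_of_le hlim tendsto_const_nhds
      (fun n => ?_) (fun n => ?_)
    · have hn : (0 : ℝ) < (n : ℝ) + 1 := by positivity
      simp only [r]
      rw [le_div_iff₀ hn, sub_mul, one_div, inv_mul_cancel₀ hn.ne']
      push_cast
      linarith [Int.le_ceil (((n : ℝ) + 1) * s)]
    · have hn : (0 : ℝ) < (n : ℝ) + 1 := by positivity
      simp only [r]
      rw [div_le_iff₀ hn]
      push_cast
      linarith [Int.ceil_lt_add_one (((n : ℝ) + 1) * s)]
  · refine Eventually.of_forall fun n => ?_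
    have hn : (0 : ℝ) < (n : ℝ) + 1 := by positivity
    simp only [r, mem_Iio]
    rw [div_lt_iff₀ hn]
    push_cast
    linarith [Int.ceil_lt_add_one (((n : ℝ) + 1) * s)]

lemma LdContinuous.intervalIntegrable_ceilPt (h𝕋 : IsClosed 𝕋) (hsup : ¬ BddAbove 𝕋) {f : ℝ → F}
    (hf : LdContinuous 𝕋 f) (a b : ℝ) :
    IntervalIntegrable (fun u => f (ceilPt 𝕋 u)) MeasureTheory.volume a b := by
  obtain ⟨C, -, hC⟩ := hf.exists_norm_le h𝕋 (min a b) (ceilPt 𝕋 (max a b))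
  have hm := stronglyMeasurable_of_leftContinuous (hf.leftContinuous_ceilPt h𝕋 hsup)
  refine (intervalIntegrable_const (c := C)).mono_fun hm.aestronglyMeasurable ?_
  refine MeasureTheory.ae_restrict_of_forall_mem measurableSet_uIoc fun u hu => ?_
  have h1 := ceilPt_mem h𝕋 hsup u
  have h2 := ceilPt_mem h𝕋 hsup (max a b)
  exact (hC _ ⟨h1.1, hu.1.le.trans h1.2, ceilPt_le h2.1 (hu.2.trans h2.2)⟩).trans (le_abs_self C)

variable [NormedSpace ℝ F]

/-- Every ld-continuous function has a nabla antiderivative. -/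
lemma LdContinuous.exists_antideriv [CompleteSpace F] (h𝕋 : IsClosed 𝕋) (hsup : ¬ BddAbove 𝕋)
    {f : ℝ → F} (hf : LdContinuous 𝕋 f) :
    ∃ G : ℝ → F, ∀ t ∈ kappa 𝕋, HasNablaDerivAt 𝕋 G (f t) t := by
  -- On a gap `(ρ(t), t]` the integrand is constantly `f(t)`, so an ordinary integral reproduces the
  -- jump `ν(t) f(t)`.
  refine ⟨fun t => ∫ u in (0 : ℝ)..t, f (ceilPt 𝕋 u), fun t ht => ?_⟩
  have hint := hf.intervalIntegrable_ceilPt h𝕋 hsup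
  have hdiff : ∀ s, (∫ u in (0 : ℝ)..rho 𝕋 t, f (ceilPt 𝕋 u)) - (∫ u in (0 : ℝ)..s, f (ceilPt 𝕋 u))
      - (rho 𝕋 t - s) • f t = ∫ u in s..rho 𝕋 t, (f (ceilPt 𝕋 u) - f t) := by
    intro s
    rw [intervalIntegral.integral_sub (hint _ _) intervalIntegrable_const,
      intervalIntegral.integral_const, intervalIntegral.integral_interval_sub_left (hint _ _)
      (hint _ _)]
  intro ε hε
  simp only [hdiff]
  rcases rho_eq_or_lt 𝕋 t with h | h
  · have hc := ((hf t ht.1).1 h).tendsto.eventually (Metric.ball_mem_nhds _ hε)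
    obtain ⟨δ, hδ, hball⟩ := Metric.mem_nhdsWithin_iff.1 hc
    filter_upwards [inter_mem_nhdsWithin 𝕋 (Metric.ball_mem_nhds t hδ)] with s hs
    rw [h]
    refine intervalIntegral.norm_integral_le_of_norm_le_const fun u hu => ?_
    have h1 := ceilPt_mem h𝕋 hsup u
    have hlo : min s t ≤ ceilPt 𝕋 u := hu.1.le.trans h1.2
    have hhi : ceilPt 𝕋 u ≤ max s t :=
      ceilPt_le (by rcases max_choice s t with e | e <;> rw [e]; exacts [hs.1, ht.1]) hu.2
    have hsb := abs_lt.1 (Real.dist_eq s t ▸ Metric.mem_ball.1 hs.2)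
    have : ceilPt 𝕋 u ∈ Metric.ball t δ ∩ 𝕋 := by
      refine ⟨?_, h1.1⟩
      rw [Metric.mem_ball, Real.dist_eq, abs_lt]
      rcases le_total s t with e | e
      · rw [min_eq_left e] at hlo
        rw [max_eq_right e] at hhi
        constructor <;> linarith
      · rw [min_eq_right e] at hlo
        rw [max_eq_left e] at hhi
        constructor <;> linarith
    have := hball this
    exact (dist_eq_norm (f (ceilPt 𝕋 u)) (f t) ▸ Metric.mem_ball.1 this).le
  · obtain ⟨C, hC0, hC⟩ := hf.exists_norm_le h𝕋 t (ceilPt 𝕋 (t + 1))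
    -- For `s > t` one has `|ρ(t) - s| ≥ t - ρ(t)`, so it suffices that `2 C (s - t) ≤ ε (t -
    -- ρ(t))`. The `+ 1` covers `C = 0`, and the minimum with `1` keeps `s` where `C` is a bound.
    have hδ : 0 < min 1 (ε * (t - rho 𝕋 t) / (2 * C + 1)) := by
      have : 0 < t - rho 𝕋 t := sub_pos.2 h
      positivity
    have hvan : ∫ u in t..rho 𝕋 t, (f (ceilPt 𝕋 u) - f t) = 0 := by
      rw [← intervalIntegral.integral_zero (a := t) (b := rho 𝕋 t)]
      refine intervalIntegral.integral_congr_ae (Eventually.of_forall fun u hu => ?_)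
      rw [uIoc_of_ge h.le] at hu
      have h1 := ceilPt_mem h𝕋 hsup u
      have : ceilPt 𝕋 u = t := by
        refine le_antisymm (ceilPt_le ht.1 hu.2) (not_lt.1 fun h' => ?_)
        exact absurd (le_rho h1.1 h') (not_le.2 (hu.1.trans_le h1.2))
      rw [this, sub_self]
    rw [nhdsWithin_eq_of_rho_lt ht.1 h, eventually_sup]
    refine ⟨?_, ?_⟩
    · rw [eventually_pure, hvan, norm_zero]
      positivity
    · filter_upwards [self_mem_nhdsWithin, mem_nhdsWithin_of_mem_nhds
        (Iio_mem_nhds (lt_add_of_pos_right t hδ))] with s hs hs'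
      have hst : t < s := hs.2
      have hs1 : s < t + 1 := lt_of_lt_of_le hs' (add_le_add_right (min_le_left _ _) t)
      have hs2 : s - t < ε * (t - rho 𝕋 t) / (2 * C + 1) := by
        have := lt_of_lt_of_le hs' (add_le_add_right (min_le_right _ _) t)
        linarith
      have hint' : ∀ a b, IntervalIntegrable (fun u => f (ceilPt 𝕋 u) - f t)
          MeasureTheory.volume a b := fun a b => (hint a b).sub intervalIntegrable_const
      rw [← intervalIntegral.integral_add_adjacent_intervals (hint' s t) (hint' t _), hvan, add_zero]
      have hbd : ‖∫ u in s..t, (f (ceilPt 𝕋 u) - f t)‖ ≤ (2 * C) * |t - s| := by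
        refine intervalIntegral.norm_integral_le_of_norm_le_const fun u hu => ?_
        rw [uIoc_of_ge hst.le] at hu
        have h1 := ceilPt_mem h𝕋 hsup u
        have h2 := ceilPt_mem h𝕋 hsup (t + 1)
        have h3 := hC _ ⟨h1.1, hu.1.le.trans h1.2, ceilPt_le h2.1 ((hu.2.trans hs1.le).trans h2.2)⟩
        have h4 := hC t ⟨ht.1, le_rfl, le_trans (by linarith) h2.2⟩
        linarith [norm_sub_le (f (ceilPt 𝕋 u)) (f t)]
      refine hbd.trans ?_
      rw [abs_of_neg (sub_neg.2 hst), abs_of_neg (sub_neg.2 (h.trans hst))]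
      rw [lt_div_iff₀ (by positivity)] at hs2
      nlinarith

lemma LdContinuous.hasNablaDerivAt_nablaIntegral (h𝕋 : IsClosed 𝕋) (hsup : ¬ BddAbove 𝕋)
    {f : ℝ → ℝ} (hf : LdContinuous 𝕋 f) {a t : ℝ} (ha : a ∈ 𝕋) (ht : t ∈ kappa 𝕋) :
    HasNablaDerivAt 𝕋 (nablaIntegral 𝕋 f a) (f t) t := by
  obtain ⟨G, hG⟩ := hf.exists_antideriv h𝕋 hsup
  have h := (hG t ht).sub (hasNablaDerivAt_const (G a))
  rw [sub_zero] at h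
  refine h.congr ?_ (nablaIntegral_eq h𝕋 hG ha (rho_mem h𝕋 ht.1)).symm
  filter_upwards [self_mem_nhdsWithin] with s hs using (nablaIntegral_eq h𝕋 hG ha hs).symm

lemma LdContinuous.nablaIntegral_self (h𝕋 : IsClosed 𝕋) (hsup : ¬ BddAbove 𝕋)
    {f : ℝ → ℝ} (hf : LdContinuous 𝕋 f) {a : ℝ} (ha : a ∈ 𝕋) : nablaIntegral 𝕋 f a a = 0 := by
  obtain ⟨G, hG⟩ := hf.exists_antideriv h𝕋 hsup
  rw [nablaIntegral_eq h𝕋 hG ha ha, sub_self]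

lemma LdContinuous.nablaIntegral_sub_left (h𝕋 : IsClosed 𝕋) (hsup : ¬ BddAbove 𝕋)
    {f : ℝ → ℝ} (hf : LdContinuous 𝕋 f) {a b c : ℝ} (ha : a ∈ 𝕋) (hb : b ∈ 𝕋) (hc : c ∈ 𝕋) :
    nablaIntegral 𝕋 f b c = nablaIntegral 𝕋 f a c - nablaIntegral 𝕋 f a b := by
  obtain ⟨G, hG⟩ := hf.exists_antideriv h𝕋 hsup
  rw [nablaIntegral_eq h𝕋 hG ha hc, nablaIntegral_eq h𝕋 hG hb hc, nablaIntegral_eq h𝕋 hG ha hb]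
  ring

/-- `nablaDeriv` takes the default value `0` at a right-scattered minimum; that point is isolated,
so ld-continuity does not see it. -/
lemma LdContinuous.congr_kappa {F : Type*} [NormedAddCommGroup F] {f g : ℝ → F}
    (hf : LdContinuous 𝕋 f) (h : EqOn g f (kappa 𝕋)) : LdContinuous 𝕋 g := by
  intro t ht
  by_cases hk : t ∈ kappa 𝕋
  · have hev : ∀ᶠ s in 𝓝[𝕋] t, g s = f s := by
      filter_upwards [eventually_mem_kappa hk] with s hs using h hs
    exact ⟨fun h' => ((hf t ht).1 h').congr_of_eventuallyEq hev (h hk), fun h' =>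
      let ⟨l, hl⟩ := (hf t ht).2 h'
      ⟨l, hl.congr' ((hev.filter_mono (nhdsWithin_mono t inter_subset_left)).mono
        fun s hs => hs.symm)⟩⟩
  · refine ⟨fun _ => ?_, fun _ => ⟨g t, ?_⟩⟩
    · rw [ContinuousWithinAt, nhdsWithin_eq_pure ht hk]
      exact tendsto_pure_nhds _ _
    · refine Tendsto.mono_left (tendsto_pure_nhds g t) ?_
      rw [← nhdsWithin_eq_pure ht hk]
      exact nhdsWithin_mono t inter_subset_left

lemma isC1ld_of_hasNablaDerivAt (hsup : ¬ BddAbove 𝕋) {f G : ℝ → F} (hf : LdContinuous 𝕋 f)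
    (hG : ∀ t ∈ kappa 𝕋, HasNablaDerivAt 𝕋 G (f t) t) : IsC1ld 𝕋 G :=
  ⟨fun t ht => ⟨ht, _, hG t ht⟩, hf.congr_kappa fun t ht => (hG t ht).nablaDeriv_eq hsup ht⟩

lemma IsC1ld.hasNablaDerivAt {G : ℝ → F} (hG : IsC1ld 𝕋 G) :
    ∀ t ∈ kappa 𝕋, HasNablaDerivAt 𝕋 G (nablaDeriv 𝕋 G t) t := fun t ht =>
  (hG.1 t ht).hasNablaDerivAt

lemma IsC1ld.continuousOn {G : ℝ → F} (hG : IsC1ld 𝕋 G) : ContinuousOn G 𝕋 :=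
  continuousOn_of_hasNablaDerivAt hG.hasNablaDerivAt

end Antiderivative

/-! ### Linearity of the integral and passage to uniform limits -/

section Linear

variable {𝕋 : Set ℝ}

lemma nablaIntegral_sub_div (h𝕋 : IsClosed 𝕋) (hsup : ¬ BddAbove 𝕋) {f g : ℝ → ℝ}
    (hf : LdContinuous 𝕋 f) (hg : LdContinuous 𝕋 g) (c : ℝ) {a b : ℝ} (ha : a ∈ 𝕋) (hb : b ∈ 𝕋) :
    nablaIntegral 𝕋 (fun t => (f t - g t) / c) a b
      = (nablaIntegral 𝕋 f a b - nablaIntegral 𝕋 g a b) / c := by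
  obtain ⟨F, hF⟩ := hf.exists_antideriv h𝕋 hsup
  obtain ⟨G, hG⟩ := hg.exists_antideriv h𝕋 hsup
  have hH : IsNablaAntideriv 𝕋 (fun t => (f t - g t) / c) (fun s => c⁻¹ • (F s - G s)) :=
    fun t ht => by
      have := ((hF t ht).sub (hG t ht)).const_smul c⁻¹
      rwa [smul_eq_mul, inv_mul_eq_div] at this
  rw [nablaIntegral_eq h𝕋 hH ha hb, nablaIntegral_eq h𝕋 hF ha hb, nablaIntegral_eq h𝕋 hG ha hb]
  simp only [smul_eq_mul]
  ring

/-- The mean value inequality for the difference of the antiderivatives bounds the error by the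
uniform distance of the integrands times `b - a`. -/
lemma tendstoUniformlyOn_nablaIntegral (h𝕋 : IsClosed 𝕋) (hsup : ¬ BddAbove 𝕋) {ι : Type*}
    {l : Filter ι} {f : ι → ℝ → ℝ} {f₀ : ℝ → ℝ} (hf : ∀ᶠ i in l, LdContinuous 𝕋 (f i))
    (hf₀ : LdContinuous 𝕋 f₀) {a b : ℝ} (ha : a ∈ 𝕋)
    (h : TendstoUniformlyOn f f₀ l (𝕋 ∩ Icc a b)) :
    TendstoUniformlyOn (fun i => nablaIntegral 𝕋 (f i) a) (nablaIntegral 𝕋 f₀ a) l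
      (𝕋 ∩ Icc a b) := by
  rw [Metric.tendstoUniformlyOn_iff] at *
  intro η hη
  have hη' : 0 < η / (|b - a| + 1) := by positivity
  filter_upwards [hf, h _ hη'] with i hi hi' t ht
  obtain ⟨F, hF⟩ := hi.exists_antideriv h𝕋 hsup
  obtain ⟨F₀, hF₀⟩ := hf₀.exists_antideriv h𝕋 hsup
  rw [nablaIntegral_eq h𝕋 hF ha ht.1, nablaIntegral_eq h𝕋 hF₀ ha ht.1, Real.dist_eq]
  have h1 := norm_sub_le_of_norm_nablaDeriv_le h𝕋 (f := fun s => f₀ s - f i s)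
    (G := fun s => F₀ s - F s) (fun s hs => (hF₀ s hs).sub (hF s hs)) ha ht.1 ht.2.1
    (C := η / (|b - a| + 1)) fun s hs h1 h2 => by
      have := hi' s ⟨hs, h1.le, h2.trans ht.2.2⟩
      rw [Real.dist_eq] at this
      exact this.le
  rw [Real.norm_eq_abs] at h1
  calc |F₀ t - F₀ a - (F t - F a)| = |F₀ t - F t - (F₀ a - F a)| := by congr 1; ring
    _ ≤ η / (|b - a| + 1) * (t - a) := h1
    _ < η := by
      rw [div_mul_eq_mul_div, div_lt_iff₀ (by positivity)]
      have := le_abs_self (b - a)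
      have := ht.2.2
      nlinarith

end Linear

/-! ### Uniform convergence of difference quotients -/

section DiffQuot

variable {𝕋 : Set ℝ} {Y : Type*} [NormedAddCommGroup Y] [NormedSpace ℝ Y] {f : ℝ → Y → ℝ}

lemma IsC1ldIntegrand.differentiableAt (hf : IsC1ldIntegrand 𝕋 f) {t : ℝ} (ht : t ∈ 𝕋) (y : Y) :
    DifferentiableAt ℝ (f t) y :=
  (hf.1 t ht).differentiable one_ne_zero y

lemma IsC1ldIntegrand.ldContinuous_fderiv (hf : IsC1ldIntegrand 𝕋 f) {y : ℝ → Y}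
    (hy : LdContinuous 𝕋 y) : LdContinuous 𝕋 fun t => fderiv ℝ (f t) (y t) :=
  hf.2.2.comp hy

lemma IsC1ldIntegrand.ldContinuous_fderiv_apply (hf : IsC1ldIntegrand 𝕋 f) {y q : ℝ → Y}
    (hy : LdContinuous 𝕋 y) (hq : LdContinuous 𝕋 q) :
    LdContinuous 𝕋 fun t => fderiv ℝ (f t) (y t) (q t) :=
  ((hf.ldContinuous_fderiv hy).prodMk hq).continuous_comp
    (φ := fun r : (Y →L[ℝ] ℝ) × Y => r.1 r.2) isBoundedBilinearMap_apply.continuous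

/-- Difference quotients of a `C¹` integrand converge uniformly on compact sets. -/
lemma IsC1ldIntegrand.tendstoUniformlyOn_diffQuot (h𝕋 : IsClosed 𝕋) (hf : IsC1ldIntegrand 𝕋 f)
    {y q : ℝ → Y} (hy : LdContinuous 𝕋 y) (hq : LdContinuous 𝕋 q) {Q : ℝ → ℝ → Y} {a b : ℝ}
    (hQ : TendstoUniformlyOn Q q (𝓝[≠] 0) (𝕋 ∩ Icc a b)) :
    TendstoUniformlyOn (fun ε t => (f t (y t + ε • Q ε t) - f t (y t)) / ε)
      (fun t => fderiv ℝ (f t) (y t) (q t)) (𝓝[≠] 0) (𝕋 ∩ Icc a b) := by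
  obtain ⟨M, hM0, hM⟩ := hq.exists_norm_le h𝕋 a b
  obtain ⟨C, hC0, hC⟩ := (hf.ldContinuous_fderiv hy).exists_norm_le h𝕋 a b
  rw [Metric.tendstoUniformlyOn_iff] at *
  intro η hη
  -- The error is at most `κ (M + 1)`, from the mean value inequality along the increment, plus `C
  -- κ`, from replacing `Q` by `q`. The last `+ 1` makes the sum strictly less than `η`.
  set κ := η / (M + 1 + C + 1) with hκ
  have hκ0 : 0 < κ := by positivity
  obtain ⟨δ, hδ, hδ'⟩ := hf.2.2.exists_norm_sub_lt h𝕋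
    (fun t ht => (hf.1 t ht).continuous_fderiv one_ne_zero) hy a b hκ0
  have hsmall : ∀ᶠ ε : ℝ in 𝓝[≠] 0, |ε| * (M + 1) < δ := by
    have : Tendsto (fun ε : ℝ => |ε| * (M + 1)) (𝓝[≠] 0) (𝓝 0) := by
      have h : Continuous fun ε : ℝ => |ε| * (M + 1) := by fun_prop
      simpa using (h.tendsto 0).mono_left nhdsWithin_le_nhds
    exact this.eventually (gt_mem_nhds hδ)
  filter_upwards [hsmall, hQ _ (lt_min one_pos hκ0), self_mem_nhdsWithin] with ε h1 h2 h3 t ht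
  have hε : ε ≠ 0 := h3
  have hd := h2 t ht
  rw [dist_comm, dist_eq_norm, lt_min_iff] at hd
  have hQn : ‖Q ε t‖ ≤ M + 1 := by
    have := norm_add_le (Q ε t - q t) (q t)
    rw [sub_add_cancel] at this
    linarith [hM t ht, hd.1]
  have hmem : y t + ε • Q ε t ∈ Metric.ball (y t) δ := by
    rw [mem_ball_iff_norm, add_sub_cancel_left, norm_smul, Real.norm_eq_abs]
    exact (mul_le_mul_of_nonneg_left hQn (abs_nonneg _)).trans_lt h1
  have hmv := (convex_ball (y t) δ).norm_image_sub_le_of_norm_fderiv_le' (𝕜 := ℝ) (f := f t)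
    (φ := fderiv ℝ (f t) (y t)) (C := κ) (fun u _ => hf.differentiableAt ht.1 u)
    (fun u hu => by
      have := hδ' t ht (u - y t) (by simpa [dist_eq_norm] using hu)
      rw [add_sub_cancel] at this
      exact this.le) (Metric.mem_ball_self hδ) hmem
  rw [add_sub_cancel_left, map_smul, smul_eq_mul, norm_smul, Real.norm_eq_abs, Real.norm_eq_abs]
    at hmv
  have e1 : |(f t (y t + ε • Q ε t) - f t (y t)) / ε - fderiv ℝ (f t) (y t) (Q ε t)|
      ≤ κ * (M + 1) := by
    have : (f t (y t + ε • Q ε t) - f t (y t)) / ε - fderiv ℝ (f t) (y t) (Q ε t)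
        = (f t (y t + ε • Q ε t) - f t (y t) - ε * fderiv ℝ (f t) (y t) (Q ε t)) / ε := by
      field_simp
    rw [this, abs_div, div_le_iff₀ (abs_pos.2 hε)]
    refine hmv.trans ?_
    have := abs_pos.2 hε
    calc κ * (|ε| * ‖Q ε t‖) ≤ κ * (|ε| * (M + 1)) := by gcongr
      _ = κ * (M + 1) * |ε| := by ring
  have e2 : |fderiv ℝ (f t) (y t) (Q ε t) - fderiv ℝ (f t) (y t) (q t)| ≤ C * κ := by
    rw [← map_sub, ← Real.norm_eq_abs]
    exact (ContinuousLinearMap.le_opNorm _ _).trans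
      (mul_le_mul (hC t ht) hd.2.le (norm_nonneg _) hC0)
  rw [dist_comm, Real.dist_eq]
  calc |(f t (y t + ε • Q ε t) - f t (y t)) / ε - fderiv ℝ (f t) (y t) (q t)|
      ≤ κ * (M + 1) + C * κ := (abs_sub_le _ _ _).trans (add_le_add e1 e2)
    _ < η := by
      have : η = κ * (M + 1 + C + 1) := by rw [hκ]; field_simp
      nlinarith

end DiffQuot

/-! ### Partial gradients as components of the full derivative -/

section Gradients

variable {n : ℕ}

local notation "E" => EuclideanSpace ℝ (Fin n)

lemma gx_eq {g : ℝ → E × E → ℝ} {t : ℝ} {y : E × E} (h : DifferentiableAt ℝ (g t) y) :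
    gx g t y = (InnerProductSpace.toDual ℝ E).symm
      (fderiv ℝ (g t) y ∘L ContinuousLinearMap.inl ℝ E E) := by
  rw [gx, gradient]
  congr 1
  exact (h.hasFDerivAt.comp (𝕜 := ℝ) y.1 (hasFDerivAt_prodMk_left y.1 y.2)).fderiv

lemma gv_eq {g : ℝ → E × E → ℝ} {t : ℝ} {y : E × E} (h : DifferentiableAt ℝ (g t) y) :
    gv g t y = (InnerProductSpace.toDual ℝ E).symm
      (fderiv ℝ (g t) y ∘L ContinuousLinearMap.inr ℝ E E) := by
  rw [gv, gradient]
  congr 1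
  exact (h.hasFDerivAt.comp (𝕜 := ℝ) y.2 (hasFDerivAt_prodMk_right y.1 y.2)).fderiv

lemma fderiv_eq_inner_gx_add_inner_gv {g : ℝ → E × E → ℝ} {t : ℝ} {y : E × E}
    (h : DifferentiableAt ℝ (g t) y) (u v : E) :
    fderiv ℝ (g t) y (u, v) = inner ℝ (gx g t y) u + inner ℝ (gv g t y) v := by
  rw [gx_eq h, gv_eq h, InnerProductSpace.toDual_symm_apply, InnerProductSpace.toDual_symm_apply]
  simp [← map_add]

lemma Lx_eq {L : ℝ → E × E × ℝ → ℝ} {t : ℝ} {y : E × E × ℝ} (h : DifferentiableAt ℝ (L t) y) :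
    Lx L t y = (InnerProductSpace.toDual ℝ E).symm
      (fderiv ℝ (L t) y ∘L ContinuousLinearMap.inl ℝ E (E × ℝ)) := by
  rw [Lx, gradient]
  congr 1
  exact (h.hasFDerivAt.comp (𝕜 := ℝ) y.1 (hasFDerivAt_prodMk_left y.1 y.2)).fderiv

lemma Lv_eq {L : ℝ → E × E × ℝ → ℝ} {t : ℝ} {y : E × E × ℝ} (h : DifferentiableAt ℝ (L t) y) :
    Lv L t y = (InnerProductSpace.toDual ℝ E).symm
      (fderiv ℝ (L t) y ∘L (ContinuousLinearMap.inr ℝ E (E × ℝ) ∘L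
        ContinuousLinearMap.inl ℝ E ℝ)) := by
  rw [Lv, gradient]
  congr 1
  exact (h.hasFDerivAt.comp (𝕜 := ℝ) y.2.1 ((hasFDerivAt_prodMk_right y.1 y.2).comp y.2.1
    (hasFDerivAt_prodMk_left y.2.1 y.2.2))).fderiv

lemma Lz_eq {L : ℝ → E × E × ℝ → ℝ} {t : ℝ} {y : E × E × ℝ} (h : DifferentiableAt ℝ (L t) y) :
    Lz L t y = fderiv ℝ (L t) y (0, 0, 1) := by
  have := (h.hasFDerivAt.comp (𝕜 := ℝ) y.2.2 ((hasFDerivAt_prodMk_right y.1 y.2).comp y.2.2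
    (hasFDerivAt_prodMk_right y.2.1 y.2.2))).hasDerivAt.deriv
  exact this

lemma fderiv_eq_inner_Lx_add {L : ℝ → E × E × ℝ → ℝ} {t : ℝ} {y : E × E × ℝ}
    (h : DifferentiableAt ℝ (L t) y) (u v : E) (w : ℝ) :
    fderiv ℝ (L t) y (u, v, w)
      = inner ℝ (Lx L t y) u + inner ℝ (Lv L t y) v + Lz L t y * w := by
  rw [Lx_eq h, Lv_eq h, Lz_eq h, InnerProductSpace.toDual_symm_apply,
    InnerProductSpace.toDual_symm_apply, mul_comm, ← smul_eq_mul w, ← map_smul]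
  simp [← map_add]

variable {𝕋 : Set ℝ}
  {L : ℝ → EuclideanSpace ℝ (Fin n) × EuclideanSpace ℝ (Fin n) × ℝ → ℝ}
  {g : ℝ → EuclideanSpace ℝ (Fin n) × EuclideanSpace ℝ (Fin n) → ℝ}

lemma continuous_toDual_symm_comp {F : Type*} [NormedAddCommGroup F] [NormedSpace ℝ F]
    (B : E →L[ℝ] F) : Continuous fun A : F →L[ℝ] ℝ =>
      (InnerProductSpace.toDual ℝ E).symm (A ∘L B) :=
  (InnerProductSpace.toDual ℝ E).symm.continuous.comp (continuous_id.clm_comp continuous_const)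

lemma IsC1ldIntegrand.ldContinuous_gx (hg : IsC1ldIntegrand 𝕋 g) {y : ℝ → E × E}
    (hy : LdContinuous 𝕋 y) : LdContinuous 𝕋 fun t => gx g t (y t) :=
  ((hg.ldContinuous_fderiv hy).continuous_comp (continuous_toDual_symm_comp _)).congr
    fun _ ht => gx_eq (hg.differentiableAt ht _)

lemma IsC1ldIntegrand.ldContinuous_gv (hg : IsC1ldIntegrand 𝕋 g) {y : ℝ → E × E}
    (hy : LdContinuous 𝕋 y) : LdContinuous 𝕋 fun t => gv g t (y t) :=
  ((hg.ldContinuous_fderiv hy).continuous_comp (continuous_toDual_symm_comp _)).congr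
    fun _ ht => gv_eq (hg.differentiableAt ht _)

lemma IsC1ldIntegrand.ldContinuous_Lx (hL : IsC1ldIntegrand 𝕋 L) {y : ℝ → E × E × ℝ}
    (hy : LdContinuous 𝕋 y) : LdContinuous 𝕋 fun t => Lx L t (y t) :=
  ((hL.ldContinuous_fderiv hy).continuous_comp (continuous_toDual_symm_comp _)).congr
    fun _ ht => Lx_eq (hL.differentiableAt ht _)

lemma IsC1ldIntegrand.ldContinuous_Lv (hL : IsC1ldIntegrand 𝕋 L) {y : ℝ → E × E × ℝ}
    (hy : LdContinuous 𝕋 y) : LdContinuous 𝕋 fun t => Lv L t (y t) :=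
  ((hL.ldContinuous_fderiv hy).continuous_comp (continuous_toDual_symm_comp _)).congr
    fun _ ht => Lv_eq (hL.differentiableAt ht _)

lemma IsC1ldIntegrand.ldContinuous_Lz (hL : IsC1ldIntegrand 𝕋 L) {y : ℝ → E × E × ℝ}
    (hy : LdContinuous 𝕋 y) : LdContinuous 𝕋 fun t => Lz L t (y t) :=
  ((hL.ldContinuous_fderiv hy).continuous_comp
    (φ := fun A : E × E × ℝ →L[ℝ] ℝ => A (0, 0, 1)) (by fun_prop)).congr
    fun _ ht => Lz_eq (hL.differentiableAt ht _)

end Gradients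

/-! ### First variation: existence, vanishing and integration by parts -/

section FirstVariation

variable {n : ℕ} {𝕋 : Set ℝ} {a : ℝ}
  {L : ℝ → EuclideanSpace ℝ (Fin n) × EuclideanSpace ℝ (Fin n) × ℝ → ℝ}
  {g : ℝ → EuclideanSpace ℝ (Fin n) × EuclideanSpace ℝ (Fin n) → ℝ}
  {x p : ℝ → EuclideanSpace ℝ (Fin n)} {xa : EuclideanSpace ℝ (Fin n)}

lemma IsC1ld.add_smul {F : Type*} [NormedAddCommGroup F] [NormedSpace ℝ F] {x p : ℝ → F}
    (hsup : ¬ BddAbove 𝕋) (hx : IsC1ld 𝕋 x) (hp : IsC1ld 𝕋 p) (ε : ℝ) :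
    IsC1ld 𝕋 fun s => x s + ε • p s :=
  isC1ld_of_hasNablaDerivAt hsup
    (hx.2.add (hp.2.continuous_comp (continuous_const_smul ε)))
    fun t ht => (hx.hasNablaDerivAt t ht).add ((hp.hasNablaDerivAt t ht).const_smul ε)

lemma IsC1ld.nablaDeriv_add_smul {F : Type*} [NormedAddCommGroup F] [NormedSpace ℝ F]
    {x p : ℝ → F} (hsup : ¬ BddAbove 𝕋) (hx : IsC1ld 𝕋 x) (hp : IsC1ld 𝕋 p) (ε t : ℝ) :
    nablaDeriv 𝕋 (fun s => x s + ε • p s) t = nablaDeriv 𝕋 x t + ε • nablaDeriv 𝕋 p t := by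
  by_cases ht : t ∈ kappa 𝕋
  · exact ((hx.hasNablaDerivAt t ht).add
      ((hp.hasNablaDerivAt t ht).const_smul ε)).nablaDeriv_eq hsup ht
  · simp [nablaDeriv_of_notMem ht]

lemma jet_add_smul (hsup : ¬ BddAbove 𝕋) (hx : IsC1ld 𝕋 x) (hp : IsC1ld 𝕋 p) (ε t : ℝ) :
    jet 𝕋 (fun s => x s + ε • p s) t = jet 𝕋 x t + ε • jet 𝕋 p t :=
  Prod.ext rfl (hx.nablaDeriv_add_smul hsup hp ε t)

lemma IsC1ld.ldContinuous_comp_rho (h𝕋 : IsClosed 𝕋) (hx : IsC1ld 𝕋 x) :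
    LdContinuous 𝕋 fun t => x (rho 𝕋 t) :=
  LdContinuous.comp_rho h𝕋 hx.continuousOn

lemma IsC1ld.ldContinuous_jet (h𝕋 : IsClosed 𝕋) (hx : IsC1ld 𝕋 x) : LdContinuous 𝕋 (jet 𝕋 x) :=
  (hx.ldContinuous_comp_rho h𝕋).prodMk hx.2

lemma LdContinuous.continuousOn_nablaIntegral (h𝕋 : IsClosed 𝕋) (hsup : ¬ BddAbove 𝕋)
    {f : ℝ → ℝ} (hf : LdContinuous 𝕋 f) (ha : a ∈ 𝕋) : ContinuousOn (nablaIntegral 𝕋 f a) 𝕋 :=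
  continuousOn_of_hasNablaDerivAt fun _ ht => hf.hasNablaDerivAt_nablaIntegral h𝕋 hsup ha ht

lemma LdContinuous.nablaIntegral (h𝕋 : IsClosed 𝕋) (hsup : ¬ BddAbove 𝕋)
    {f : ℝ → ℝ} (hf : LdContinuous 𝕋 f) (ha : a ∈ 𝕋) : LdContinuous 𝕋 (nablaIntegral 𝕋 f a) :=
  .of_continuousOn (hf.continuousOn_nablaIntegral h𝕋 hsup ha)

lemma IsC1ldIntegrand.ldContinuous_comp {Y : Type*} [NormedAddCommGroup Y] [NormedSpace ℝ Y]
    {f : ℝ → Y → ℝ} (hf : IsC1ldIntegrand 𝕋 f) {y : ℝ → Y} (hy : LdContinuous 𝕋 y) :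
    LdContinuous 𝕋 fun t => f t (y t) :=
  hf.2.1.comp hy

lemma IsC1ld.ldContinuous_jetz (h𝕋 : IsClosed 𝕋) (hsup : ¬ BddAbove 𝕋) (ha : a ∈ 𝕋)
    (hg : IsC1ldIntegrand 𝕋 g) (hx : IsC1ld 𝕋 x) : LdContinuous 𝕋 (jetz 𝕋 a g x) :=
  (hx.ldContinuous_comp_rho h𝕋).prodMk (hx.2.prodMk
    ((hg.ldContinuous_comp (hx.ldContinuous_jet h𝕋)).nablaIntegral h𝕋 hsup ha))

/-- The first variation of `z` in the direction `p`. -/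
noncomputable def zVar (𝕋 : Set ℝ) (a : ℝ)
    (g : ℝ → EuclideanSpace ℝ (Fin n) × EuclideanSpace ℝ (Fin n) → ℝ)
    (x p : ℝ → EuclideanSpace ℝ (Fin n)) (t : ℝ) : ℝ :=
  nablaIntegral 𝕋 (fun τ => fderiv ℝ (g τ) (jet 𝕋 x τ) (jet 𝕋 p τ)) a t

/-- The first variation of the functional in the direction `p`. -/
noncomputable def firstVar (𝕋 : Set ℝ) (a : ℝ)
    (L : ℝ → EuclideanSpace ℝ (Fin n) × EuclideanSpace ℝ (Fin n) × ℝ → ℝ)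
    (g : ℝ → EuclideanSpace ℝ (Fin n) × EuclideanSpace ℝ (Fin n) → ℝ)
    (x p : ℝ → EuclideanSpace ℝ (Fin n)) (t : ℝ) : ℝ :=
  nablaIntegral 𝕋 (fun τ => fderiv ℝ (L τ) (jetz 𝕋 a g x τ)
    (p (rho 𝕋 τ), nablaDeriv 𝕋 p τ, zVar 𝕋 a g x p τ)) a t

lemma ldContinuous_zVar (h𝕋 : IsClosed 𝕋) (hsup : ¬ BddAbove 𝕋) (ha : a ∈ 𝕋)
    (hg : IsC1ldIntegrand 𝕋 g) (hx : IsC1ld 𝕋 x) (hp : IsC1ld 𝕋 p) :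
    LdContinuous 𝕋 (zVar 𝕋 a g x p) :=
  (hg.ldContinuous_fderiv_apply (hx.ldContinuous_jet h𝕋) (hp.ldContinuous_jet h𝕋)).nablaIntegral
    h𝕋 hsup ha

/-- The difference quotients of `z` converge to its first variation, uniformly on compact sets. -/
lemma tendstoUniformlyOn_zPath_diffQuot (h𝕋 : IsClosed 𝕋) (hsup : ¬ BddAbove 𝕋) (ha : a ∈ 𝕋)
    (hg : IsC1ldIntegrand 𝕋 g) (hx : IsC1ld 𝕋 x) (hp : IsC1ld 𝕋 p) (b : ℝ) :
    TendstoUniformlyOn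
      (fun ε t => (zPath 𝕋 a g (fun s => x s + ε • p s) t - zPath 𝕋 a g x t) / ε)
      (zVar 𝕋 a g x p) (𝓝[≠] 0) (𝕋 ∩ Icc a b) := by
  have hjx := hx.ldContinuous_jet h𝕋
  have hjp := hp.ldContinuous_jet h𝕋
  have hj : ∀ ε : ℝ, LdContinuous 𝕋 fun t => g t (jet 𝕋 x t + ε • jet 𝕋 p t) := fun ε =>
    hg.ldContinuous_comp (hjx.add (hjp.continuous_comp (continuous_const_smul ε)))
  have hconst : TendstoUniformlyOn (fun (_ : ℝ) t => jet 𝕋 p t) (jet 𝕋 p) (𝓝[≠] 0)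
      (𝕋 ∩ Icc a b) := fun u hu => Eventually.of_forall fun _ _ _ => refl_mem_uniformity hu
  have h1 := hg.tendstoUniformlyOn_diffQuot h𝕋 hjx hjp hconst
  refine (tendstoUniformlyOn_nablaIntegral h𝕋 hsup (Eventually.of_forall fun ε =>
    ((hj ε).sub (hg.ldContinuous_comp hjx)).continuous_comp (φ := fun r => r / ε) (by fun_prop))
    (hg.ldContinuous_fderiv_apply hjx hjp) ha h1).congr (Eventually.of_forall fun ε t ht => ?_)
  simp only [zPath, jet_add_smul hsup hx hp]
  exact nablaIntegral_sub_div h𝕋 hsup (hj ε) (hg.ldContinuous_comp hjx) ε ha ht.1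

/-- The difference quotients `A(ε, T')` converge to the first variation. -/
lemma tendsto_quotA (h𝕋 : IsClosed 𝕋) (hsup : ¬ BddAbove 𝕋) (ha : a ∈ 𝕋)
    (hL : IsC1ldIntegrand 𝕋 L) (hg : IsC1ldIntegrand 𝕋 g) (hx : IsC1ld 𝕋 x) (hp : IsC1ld 𝕋 p)
    {b : ℝ} (hb : b ∈ 𝕋) (hab : a ≤ b) :
    Tendsto (fun ε => quotA 𝕋 a L g x p ε b) (𝓝[≠] 0) (𝓝 (firstVar 𝕋 a L g x p b)) := by
  have hjz := hx.ldContinuous_jetz h𝕋 hsup ha hg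
  have hq : LdContinuous 𝕋 fun t => (p (rho 𝕋 t), nablaDeriv 𝕋 p t, zVar 𝕋 a g x p t) :=
    (hp.ldContinuous_comp_rho h𝕋).prodMk (hp.2.prodMk (ldContinuous_zVar h𝕋 hsup ha hg hx hp))
  -- Perturbing `x` by `ε p` moves the arguments of `L` by `ε` times this vector. Its last entry is
  -- itself a difference quotient, so the direction depends on `ε`.
  have hQ : TendstoUniformlyOn (fun ε t => (p (rho 𝕋 t), nablaDeriv 𝕋 p t,
      (zPath 𝕋 a g (fun s => x s + ε • p s) t - zPath 𝕋 a g x t) / ε))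
      (fun t => (p (rho 𝕋 t), nablaDeriv 𝕋 p t, zVar 𝕋 a g x p t)) (𝓝[≠] 0) (𝕋 ∩ Icc a b) := by
    have := tendstoUniformlyOn_zPath_diffQuot h𝕋 hsup ha hg hx hp b
    rw [Metric.tendstoUniformlyOn_iff] at *
    intro η hη
    filter_upwards [this η hη] with ε hε t ht
    simpa [Prod.dist_eq, hη] using hε t ht
  have h1 := hL.tendstoUniformlyOn_diffQuot h𝕋 hjz hq hQ
  have hld : ∀ ε : ℝ, LdContinuous 𝕋 fun t => (L t (jetz 𝕋 a g x t + ε •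
      (p (rho 𝕋 t), nablaDeriv 𝕋 p t,
      (zPath 𝕋 a g (fun s => x s + ε • p s) t - zPath 𝕋 a g x t) / ε)) - L t (jetz 𝕋 a g x t)) / ε := by
    intro ε
    have hz : ∀ {y : ℝ → EuclideanSpace ℝ (Fin n)}, IsC1ld 𝕋 y → LdContinuous 𝕋 (zPath 𝕋 a g y) :=
      fun hy => (hg.ldContinuous_comp (hy.ldContinuous_jet h𝕋)).nablaIntegral h𝕋 hsup ha
    have h2 : LdContinuous 𝕋 fun t => (p (rho 𝕋 t), nablaDeriv 𝕋 p t,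
        (zPath 𝕋 a g (fun s => x s + ε • p s) t - zPath 𝕋 a g x t) / ε) :=
      (hp.ldContinuous_comp_rho h𝕋).prodMk (hp.2.prodMk
        (((hz (hx.add_smul hsup hp ε)).sub (hz hx)).continuous_comp (φ := fun r => r / ε)
          (by fun_prop)))
    exact ((hL.ldContinuous_comp (hjz.add (h2.continuous_comp (continuous_const_smul ε)))).sub
      (hL.ldContinuous_comp hjz)).continuous_comp (φ := fun r => r / ε) (by fun_prop)
  refine ((tendstoUniformlyOn_nablaIntegral h𝕋 hsup (Eventually.of_forall hld)
    (hL.ldContinuous_fderiv_apply hjz hq) ha h1).tendsto_at ⟨hb, hab, le_rfl⟩).congr' ?_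
  filter_upwards [self_mem_nhdsWithin] with ε hε
  have hε0 : ε ≠ 0 := hε
  rw [quotA]
  congr 1
  ext t
  congr 3
  simp only [jetz, Prod.smul_mk, Prod.mk_add_mk, smul_eq_mul]
  rw [mul_div_cancel₀ _ hε0, add_sub_cancel]

/-- The path `x + ε p` is admissible because `p(a) = 0`, and the infimum over one tail is at most
the lower limit, which is nonpositive by maximality. -/
lemma infV_nonpos (h𝕋 : IsClosed 𝕋) (hsup : ¬ BddAbove 𝕋) (ha : a ∈ 𝕋)
    (hL : IsC1ldIntegrand 𝕋 L) (hg : IsC1ldIntegrand 𝕋 g) (hmax : IsWeakMaximizer 𝕋 a xa L g x)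
    (hp : IsC1ld 𝕋 p) (hpa : p a = 0) {ε : ℝ} (hε : ε ≠ 0) {T : ℝ} :
    infV 𝕋 a L g x p ε T ≤ 0 := by
  have hx := hmax.1.1
  have hy := hx.add_smul hsup hp ε
  refine le_trans ?_ (hmax.2 (fun s => x s + ε • p s) ⟨hy, by simp [hpa, hmax.1.2]⟩)
  have key : ∀ b ∈ 𝕋, nablaIntegral 𝕋 (fun t => L t (jetz 𝕋 a g (fun s => x s + ε • p s) t)
      - L t (jetz 𝕋 a g x t)) a b = ε * quotA 𝕋 a L g x p ε b := by
    intro b hb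
    have h1 := hL.ldContinuous_comp (hy.ldContinuous_jetz h𝕋 hsup ha hg)
    have h2 := hL.ldContinuous_comp (hx.ldContinuous_jetz h𝕋 hsup ha hg)
    have h3 := nablaIntegral_sub_div h𝕋 hsup h1 h2 ε ha hb
    have h4 := nablaIntegral_sub_div h𝕋 hsup h1 h2 1 ha hb
    simp only [div_one] at h4
    rw [h4]
    simp only [jetz, hx.nablaDeriv_add_smul hsup hp] at h3 ⊢
    rw [quotA]
    simp only [jetz]
    rw [h3, mul_div_cancel₀ _ hε]
  refine le_liminf_of_le (by isBoundedDefault) ?_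
  rw [eventually_inf_principal]
  filter_upwards [eventually_ge_atTop T] with b hb hb'
  rw [key b hb']
  exact iInf₂_le b ⟨hb', hb⟩

/-- The first variation of the functional at a weak maximizer vanishes at every upper end point. -/
lemma IsWeakMaximizer.firstVar_eq_zero (h𝕋 : IsClosed 𝕋) (hsup : ¬ BddAbove 𝕋) (ha : a ∈ 𝕋)
    (hL : IsC1ldIntegrand 𝕋 L) (hg : IsC1ldIntegrand 𝕋 g) (hmax : IsWeakMaximizer 𝕋 a xa L g x)
    (hp : IsC1ld 𝕋 p) (hpa : p a = 0) {T : ℝ} (hT : T ∈ 𝕋) (haT : a < T)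
    (hlim : ∃ l : ℝ, Tendsto (fun ε : ℝ => infV 𝕋 a L g x p ε T / (ε : EReal)) (𝓝[≠] 0)
      (𝓝 (l : EReal))) : firstVar 𝕋 a L g x p T = 0 := by
  obtain ⟨l, hl⟩ := hlim
  have hq := (continuous_coe_real_ereal.tendsto _).comp
    (tendsto_quotA h𝕋 hsup ha hL hg hmax.1.1 hp hT haT.le)
  have hgt : 𝓝[>] (0 : ℝ) ≤ 𝓝[≠] 0 := nhdsWithin_mono _ fun r hr => ne_of_gt hr
  have hlt : 𝓝[<] (0 : ℝ) ≤ 𝓝[≠] 0 := nhdsWithin_mono _ fun r hr => ne_of_lt hr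
  have hle : ∀ ε : ℝ, infV 𝕋 a L g x p ε T ≤ ((ε * quotA 𝕋 a L g x p ε T : ℝ) : EReal) :=
    fun ε => iInf₂_le T ⟨hT, self_mem_Ici⟩
  have hdiv : ∀ ε : ℝ, ε ≠ 0 → ((ε * quotA 𝕋 a L g x p ε T : ℝ) : EReal) / (ε : EReal)
      = (quotA 𝕋 a L g x p ε T : EReal) := fun ε hε => by
    rw [← EReal.coe_div, mul_div_cancel_left₀ _ hε]
  -- A nonpositive numerator gives `l ≤ 0` as `ε → 0⁺` and `l ≥ 0` as `ε → 0⁻`.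
  have l1 : (l : EReal) ≤ 0 := by
    refine le_of_tendsto (hl.mono_left hgt) ?_
    filter_upwards [self_mem_nhdsWithin] with ε hε
    exact EReal.div_nonpos_of_nonpos_of_nonneg
      (infV_nonpos h𝕋 hsup ha hL hg hmax hp hpa (ne_of_gt hε)) (EReal.coe_nonneg.2 (le_of_lt hε))
  have l2 : (0 : EReal) ≤ l := by
    refine ge_of_tendsto (hl.mono_left hlt) ?_
    filter_upwards [self_mem_nhdsWithin] with ε hε
    exact EReal.div_nonneg_of_nonpos_of_nonpos
      (infV_nonpos h𝕋 hsup ha hL hg hmax hp hpa (ne_of_lt hε)) (EReal.coe_nonpos.2 (le_of_lt hε))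
  -- Dividing `hle` by `ε` keeps the inequality for `ε > 0` and reverses it for `ε < 0`, which
  -- bounds the first variation from both sides by `l`.
  have f1 : (l : EReal) ≤ (firstVar 𝕋 a L g x p T : EReal) := by
    refine le_of_tendsto_of_tendsto (hl.mono_left hgt) (hq.mono_left hgt) ?_
    filter_upwards [self_mem_nhdsWithin] with ε hε
    rw [Function.comp_apply, ← hdiv ε (ne_of_gt hε)]
    exact EReal.div_le_div_right_of_nonneg (EReal.coe_nonneg.2 (le_of_lt hε)) (hle ε)
  have f2 : (firstVar 𝕋 a L g x p T : EReal) ≤ l := by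
    refine le_of_tendsto_of_tendsto (hq.mono_left hlt) (hl.mono_left hlt) ?_
    filter_upwards [self_mem_nhdsWithin] with ε hε
    rw [Function.comp_apply, ← hdiv ε (ne_of_lt hε)]
    exact EReal.div_le_div_right_of_nonpos (EReal.coe_nonpos.2 (le_of_lt hε)) (hle ε)
  exact_mod_cast le_antisymm (f2.trans l1) (l2.trans f1)

/-- The antiderivative `K(t) = ∫_a^t L_z[x, z](τ) ∇τ`. -/
noncomputable def intLz (𝕋 : Set ℝ) (a : ℝ)
    (L : ℝ → EuclideanSpace ℝ (Fin n) × EuclideanSpace ℝ (Fin n) × ℝ → ℝ)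
    (g : ℝ → EuclideanSpace ℝ (Fin n) × EuclideanSpace ℝ (Fin n) → ℝ)
    (x : ℝ → EuclideanSpace ℝ (Fin n)) (t : ℝ) : ℝ :=
  nablaIntegral 𝕋 (fun τ => Lz L τ (jetz 𝕋 a g x τ)) a t

/-- The coefficient of `p^ρ` in the first variation, where `∫_{ρ(t)}^{T'} L_z` is replaced by
`k - ∫_a^{ρ(t)} L_z`. -/
noncomputable def coeffX (𝕋 : Set ℝ) (a : ℝ)
    (L : ℝ → EuclideanSpace ℝ (Fin n) × EuclideanSpace ℝ (Fin n) × ℝ → ℝ)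
    (g : ℝ → EuclideanSpace ℝ (Fin n) × EuclideanSpace ℝ (Fin n) → ℝ)
    (x : ℝ → EuclideanSpace ℝ (Fin n)) (k t : ℝ) : EuclideanSpace ℝ (Fin n) :=
  Lx L t (jetz 𝕋 a g x t) + (k - intLz 𝕋 a L g x (rho 𝕋 t)) • gx g t (jet 𝕋 x t)

/-- The coefficient of `p^∇` in the first variation, where `∫_{ρ(t)}^{T'} L_z` is replaced by
`k - ∫_a^{ρ(t)} L_z`. -/
noncomputable def coeffV (𝕋 : Set ℝ) (a : ℝ)
    (L : ℝ → EuclideanSpace ℝ (Fin n) × EuclideanSpace ℝ (Fin n) × ℝ → ℝ)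
    (g : ℝ → EuclideanSpace ℝ (Fin n) × EuclideanSpace ℝ (Fin n) → ℝ)
    (x : ℝ → EuclideanSpace ℝ (Fin n)) (k t : ℝ) : EuclideanSpace ℝ (Fin n) :=
  Lv L t (jetz 𝕋 a g x t) + (k - intLz 𝕋 a L g x (rho 𝕋 t)) • gv g t (jet 𝕋 x t)

/-- The pairing `∫_a^t (φ · p^ρ + ψ · p^∇) ∇τ`. -/
noncomputable def pairing (𝕋 : Set ℝ) (a : ℝ) (φ ψ p : ℝ → EuclideanSpace ℝ (Fin n)) (t : ℝ) : ℝ :=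
  nablaIntegral 𝕋 (fun τ => inner ℝ (φ τ) (p (rho 𝕋 τ)) + inner ℝ (ψ τ) (nablaDeriv 𝕋 p τ)) a t

lemma hasNablaDerivAt_intLz (h𝕋 : IsClosed 𝕋) (hsup : ¬ BddAbove 𝕋) (ha : a ∈ 𝕋)
    (hL : IsC1ldIntegrand 𝕋 L) (hg : IsC1ldIntegrand 𝕋 g) (hx : IsC1ld 𝕋 x) :
    ∀ t ∈ kappa 𝕋, HasNablaDerivAt 𝕋 (intLz 𝕋 a L g x) (Lz L t (jetz 𝕋 a g x t)) t := fun _ ht =>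
  (hL.ldContinuous_Lz (hx.ldContinuous_jetz h𝕋 hsup ha hg)).hasNablaDerivAt_nablaIntegral
    h𝕋 hsup ha ht

lemma ldContinuous_sub_intLz_rho (h𝕋 : IsClosed 𝕋) (hsup : ¬ BddAbove 𝕋) (ha : a ∈ 𝕋)
    (hL : IsC1ldIntegrand 𝕋 L) (hg : IsC1ldIntegrand 𝕋 g) (hx : IsC1ld 𝕋 x) (k : ℝ) :
    LdContinuous 𝕋 fun t => k - intLz 𝕋 a L g x (rho 𝕋 t) :=
  (LdContinuous.of_continuousOn continuousOn_const).sub (LdContinuous.comp_rho h𝕋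
    (continuousOn_of_hasNablaDerivAt (hasNablaDerivAt_intLz h𝕋 hsup ha hL hg hx)))

lemma ldContinuous_coeffX (h𝕋 : IsClosed 𝕋) (hsup : ¬ BddAbove 𝕋) (ha : a ∈ 𝕋)
    (hL : IsC1ldIntegrand 𝕋 L) (hg : IsC1ldIntegrand 𝕋 g) (hx : IsC1ld 𝕋 x) (k : ℝ) :
    LdContinuous 𝕋 (coeffX 𝕋 a L g x k) :=
  (hL.ldContinuous_Lx (hx.ldContinuous_jetz h𝕋 hsup ha hg)).add
    ((ldContinuous_sub_intLz_rho h𝕋 hsup ha hL hg hx k).smul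
      (hg.ldContinuous_gx (hx.ldContinuous_jet h𝕋)))

lemma ldContinuous_coeffV (h𝕋 : IsClosed 𝕋) (hsup : ¬ BddAbove 𝕋) (ha : a ∈ 𝕋)
    (hL : IsC1ldIntegrand 𝕋 L) (hg : IsC1ldIntegrand 𝕋 g) (hx : IsC1ld 𝕋 x) (k : ℝ) :
    LdContinuous 𝕋 (coeffV 𝕋 a L g x k) :=
  (hL.ldContinuous_Lv (hx.ldContinuous_jetz h𝕋 hsup ha hg)).add
    ((ldContinuous_sub_intLz_rho h𝕋 hsup ha hL hg hx k).smul
      (hg.ldContinuous_gv (hx.ldContinuous_jet h𝕋)))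

lemma IsC1ld.ldContinuous_pairing (h𝕋 : IsClosed 𝕋) (hp : IsC1ld 𝕋 p)
    {φ ψ : ℝ → EuclideanSpace ℝ (Fin n)} (hφ : LdContinuous 𝕋 φ) (hψ : LdContinuous 𝕋 ψ) :
    LdContinuous 𝕋 fun t => inner ℝ (φ t) (p (rho 𝕋 t)) + inner ℝ (ψ t) (nablaDeriv 𝕋 p t) :=
  (hφ.inner (hp.ldContinuous_comp_rho h𝕋)).add (hψ.inner hp.2)

/-- Integration by parts in the first variation. -/
lemma firstVar_eq (h𝕋 : IsClosed 𝕋) (hsup : ¬ BddAbove 𝕋) (ha : a ∈ 𝕋)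
    (hL : IsC1ldIntegrand 𝕋 L) (hg : IsC1ldIntegrand 𝕋 g) (hx : IsC1ld 𝕋 x) (hp : IsC1ld 𝕋 p)
    (k : ℝ) {b : ℝ} (hb : b ∈ 𝕋) :
    firstVar 𝕋 a L g x p b = (intLz 𝕋 a L g x b - k) *
        pairing 𝕋 a (fun t => gx g t (jet 𝕋 x t)) (fun t => gv g t (jet 𝕋 x t)) p b
      + pairing 𝕋 a (coeffX 𝕋 a L g x k) (coeffV 𝕋 a L g x k) p b := by
  have hjx := hx.ldContinuous_jet h𝕋
  have hK := hasNablaDerivAt_intLz h𝕋 hsup ha hL hg hx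
  have hγ := hp.ldContinuous_pairing h𝕋 (hg.ldContinuous_gx hjx) (hg.ldContinuous_gv hjx)
  have hβ : ∀ t ∈ kappa 𝕋, HasNablaDerivAt 𝕋
      (pairing 𝕋 a (fun t => gx g t (jet 𝕋 x t)) (fun t => gv g t (jet 𝕋 x t)) p) _ t :=
    fun _ ht => hγ.hasNablaDerivAt_nablaIntegral h𝕋 hsup ha ht
  have hz : ∀ t ∈ 𝕋, zVar 𝕋 a g x p t
      = pairing 𝕋 a (fun t => gx g t (jet 𝕋 x t)) (fun t => gv g t (jet 𝕋 x t)) p t := by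
    intro t ht
    refine (nablaIntegral_eq h𝕋 (G := pairing 𝕋 a (fun t => gx g t (jet 𝕋 x t))
      (fun t => gv g t (jet 𝕋 x t)) p) (fun s hs => ?_) ha ht).trans ?_
    · have := hβ s hs
      rwa [← fderiv_eq_inner_gx_add_inner_gv (hg.differentiableAt hs.1 _)] at this
    · rw [pairing, pairing, hγ.nablaIntegral_self h𝕋 hsup ha, sub_zero]
  have hα := (hp.ldContinuous_pairing h𝕋 (ldContinuous_coeffX h𝕋 hsup ha hL hg hx k)
    (ldContinuous_coeffV h𝕋 hsup ha hL hg hx k))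
  have hαd : ∀ t ∈ kappa 𝕋, HasNablaDerivAt 𝕋
      (pairing 𝕋 a (coeffX 𝕋 a L g x k) (coeffV 𝕋 a L g x k) p) _ t :=
    fun _ ht => hα.hasNablaDerivAt_nablaIntegral h𝕋 hsup ha ht
  have hG : IsNablaAntideriv 𝕋 (fun τ => fderiv ℝ (L τ) (jetz 𝕋 a g x τ)
      (p (rho 𝕋 τ), nablaDeriv 𝕋 p τ, zVar 𝕋 a g x p τ)) (fun t => (intLz 𝕋 a L g x t - k) *
        pairing 𝕋 a (fun t => gx g t (jet 𝕋 x t)) (fun t => gv g t (jet 𝕋 x t)) p t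
      + pairing 𝕋 a (coeffX 𝕋 a L g x k) (coeffV 𝕋 a L g x k) p t) := by
    intro t ht
    -- In the product rule the factor `K - k` is the one evaluated at `ρ(t)`. This is where `K^ρ` in
    -- `coeffX` and `coeffV` comes from, and the terms in `k` cancel.
    have h1 := (((hβ t ht).bilin (ContinuousLinearMap.mul ℝ ℝ)
      ((hK t ht).sub (hasNablaDerivAt_const k)) ht.1)).add (hαd t ht)
    simp only [ContinuousLinearMap.mul_apply'] at h1
    convert h1 using 1
    · ext s
      ring
    · beta_reduce
      rw [fderiv_eq_inner_Lx_add (hL.differentiableAt ht.1 _), hz t ht.1, coeffX, coeffV]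
      simp only [inner_add_left, real_inner_smul_left]
      ring
  rw [firstVar, nablaIntegral_eq h𝕋 hG ha hb]
  simp only [pairing, hγ.nablaIntegral_self h𝕋 hsup ha, hα.nablaIntegral_self h𝕋 hsup ha]
  ring

end FirstVariation

/-! ### The du Bois-Reymond lemma -/

section DuBoisReymond

variable {n : ℕ} {𝕋 : Set ℝ} {a : ℝ} {φ ψ Φ p : ℝ → EuclideanSpace ℝ (Fin n)}

/-- An antiderivative of the weight `max 0 (B - t)`, together with its total increment. -/
lemma exists_weight_antideriv (h𝕋 : IsClosed 𝕋) (hsup : ¬ BddAbove 𝕋) (ha : a ∈ 𝕋) {t B : ℝ}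
    (ht : t ∈ 𝕋) (hB : B ∈ 𝕋) (hat : a < t) (htB : t < B) :
    ∃ X : ℝ → ℝ, (∀ s ∈ kappa 𝕋, HasNablaDerivAt 𝕋 X (max 0 (B - s)) s) ∧ X B - X a ≠ 0 := by
  obtain ⟨X, hX⟩ := (LdContinuous.of_continuousOn (𝕋 := 𝕋)
    (f := fun s : ℝ => max 0 (B - s)) (by fun_prop)).exists_antideriv h𝕋 hsup
  refine ⟨X, hX, fun h => ?_⟩
  have := eq_zero_of_nonneg_of_antideriv_eq h𝕋 hX ha hB (fun s _ => le_max_left _ _)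
    (sub_eq_zero.1 h) ht hat htB.le
  rw [max_eq_right (by linarith)] at this
  linarith

lemma hasNablaDerivAt_pairing (h𝕋 : IsClosed 𝕋) (hsup : ¬ BddAbove 𝕋) (ha : a ∈ 𝕋)
    (hφ : LdContinuous 𝕋 φ) (hψ : LdContinuous 𝕋 ψ) (hp : IsC1ld 𝕋 p) :
    ∀ t ∈ kappa 𝕋, HasNablaDerivAt 𝕋 (pairing 𝕋 a φ ψ p)
      (inner ℝ (φ t) (p (rho 𝕋 t)) + inner ℝ (ψ t) (nablaDeriv 𝕋 p t)) t := fun _ ht =>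
  (hp.ldContinuous_pairing h𝕋 hφ hψ).hasNablaDerivAt_nablaIntegral h𝕋 hsup ha ht

lemma pairing_self (h𝕋 : IsClosed 𝕋) (hsup : ¬ BddAbove 𝕋) (ha : a ∈ 𝕋)
    (hφ : LdContinuous 𝕋 φ) (hψ : LdContinuous 𝕋 ψ) (hp : IsC1ld 𝕋 p) :
    pairing 𝕋 a φ ψ p a = 0 :=
  (hp.ldContinuous_pairing h𝕋 hφ hψ).nablaIntegral_self h𝕋 hsup ha

lemma HasNablaDerivAt.inner {f g : ℝ → EuclideanSpace ℝ (Fin n)} {d e : EuclideanSpace ℝ (Fin n)}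
    {t : ℝ} (hf : HasNablaDerivAt 𝕋 f d t) (hg : HasNablaDerivAt 𝕋 g e t) (ht : t ∈ 𝕋) :
    HasNablaDerivAt 𝕋 (fun s => inner ℝ (f s) (g s))
      (inner ℝ d (g (rho 𝕋 t)) + inner ℝ (f t) e) t :=
  hf.bilin (innerSL ℝ) hg ht

/-- If `ψ` is, up to a constant, an antiderivative of `φ`, the pairing is a boundary term. -/
lemma pairing_eq_inner (h𝕋 : IsClosed 𝕋) (hsup : ¬ BddAbove 𝕋) (ha : a ∈ 𝕋)
    (hφ : LdContinuous 𝕋 φ) (hψ : LdContinuous 𝕋 ψ)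
    (hΦ : ∀ t ∈ kappa 𝕋, HasNablaDerivAt 𝕋 Φ (φ t) t) {c : EuclideanSpace ℝ (Fin n)}
    (hc : ∀ t ∈ 𝕋, a < t → ψ t = c + Φ t) (hp : IsC1ld 𝕋 p) (hpa : p a = 0) {b : ℝ} (hb : b ∈ 𝕋)
    (hab : a < b) : pairing 𝕋 a φ ψ p b = inner ℝ (ψ b) (p b) := by
  have h := sub_eq_sub_of_nablaDeriv_eq h𝕋 (hasNablaDerivAt_pairing h𝕋 hsup ha hφ hψ hp)
    (fun t ht => ((hasNablaDerivAt_const c).add (hΦ t ht)).inner (hp.hasNablaDerivAt t ht) ht.1)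
    ha hb hab.le fun t ht hat _ => by rw [zero_add, hc t ht hat]
  rw [pairing_self h𝕋 hsup ha hφ hψ hp, sub_zero, hpa, inner_zero_right, sub_zero,
    ← hc b hb hab] at h
  exact h

/-- The du Bois-Reymond lemma on a time scale. -/
lemma exists_eq_add_antideriv (h𝕋 : IsClosed 𝕋) (hsup : ¬ BddAbove 𝕋) (ha : a ∈ 𝕋)
    (hφ : LdContinuous 𝕋 φ) (hψ : LdContinuous 𝕋 ψ)
    (h : ∀ p : ℝ → EuclideanSpace ℝ (Fin n), IsC1ld 𝕋 p → p a = 0 → ∀ B ∈ 𝕋, a < B →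
      (∀ t ∈ 𝕋, B ≤ t → p t = 0) → ∃ T ∈ 𝕋, B ≤ T ∧ pairing 𝕋 a φ ψ p T = 0) :
    ∃ Φ : ℝ → EuclideanSpace ℝ (Fin n), (∀ t ∈ kappa 𝕋, HasNablaDerivAt 𝕋 Φ (φ t) t) ∧
      ∃ c : EuclideanSpace ℝ (Fin n), ∀ t ∈ 𝕋, a < t → ψ t = c + Φ t := by
  obtain ⟨Φ, hΦ⟩ := hφ.exists_antideriv h𝕋 hsup
  refine ⟨Φ, hΦ, ?_⟩
  have hh : LdContinuous 𝕋 fun t => ψ t - Φ t :=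
    hψ.sub (.of_continuousOn (continuousOn_of_hasNablaDerivAt hΦ))
  have key : ∀ t₁ ∈ 𝕋, ∀ t₂ ∈ 𝕋, a < t₁ → a < t₂ → ψ t₁ - Φ t₁ = ψ t₂ - Φ t₂ := by
    intro t₁ ht₁ t₂ ht₂ h1 h2
    -- One `B` beyond both points provides one constant `c` serving both.
    obtain ⟨B, hB, hB'⟩ := exists_mem_gt hsup (max t₁ t₂)
    have hB1 : t₁ < B := (le_max_left _ _).trans_lt hB'
    have hB2 : t₂ < B := (le_max_right _ _).trans_lt hB'
    obtain ⟨X, hX, hXB⟩ := exists_weight_antideriv h𝕋 hsup ha ht₁ hB h1 hB1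
    have hχ : LdContinuous 𝕋 fun s : ℝ => max 0 (B - s) := .of_continuousOn (by fun_prop)
    obtain ⟨Y, hY⟩ := (hχ.smul hh).exists_antideriv h𝕋 hsup
    -- `c` is the mean of `ψ - Φ` over `[a, B]` with weight `max 0 (B - t)`, which is exactly what
    -- makes `p(B) = 0`.
    set c := (X B - X a)⁻¹ • (Y B - Y a) with hc
    let p : ℝ → EuclideanSpace ℝ (Fin n) := fun t => (Y t - Y a) - (X t - X a) • c
    have hpd : ∀ t ∈ kappa 𝕋, HasNablaDerivAt 𝕋 p (max 0 (B - t) • (ψ t - Φ t - c)) t := by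
      intro t ht
      have h1 := ((hY t ht).sub (hasNablaDerivAt_const (Y a))).sub
        (((hX t ht).sub (hasNablaDerivAt_const (X a))).clm
          ((ContinuousLinearMap.id ℝ ℝ).smulRight c))
      rw [smul_sub _ _ c]
      simpa using h1
    have hpC : IsC1ld 𝕋 p := isC1ld_of_hasNablaDerivAt hsup
      (hχ.smul (hh.sub (.of_continuousOn continuousOn_const))) hpd
    have hpa : p a = 0 := by simp [p]
    have hpB : ∀ t ∈ 𝕋, B ≤ t → p t = 0 := by
      intro t ht hBt
      rw [eq_of_nablaDeriv_eq_zero h𝕋 hpd hB ht hBt fun s _ hs _ => by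
        rw [max_eq_left (by linarith), zero_smul]]
      simp only [p, hc]
      rw [smul_inv_smul₀ hXB, sub_self]
    obtain ⟨T, hT, hBT, hTp⟩ := h p hpC hpa B hB (h1.trans hB1) hpB
    -- Subtracting the boundary term leaves the weighted square of `ψ - Φ - c` as derivative. The
    -- increment over `[a, T]` is zero, so the square vanishes wherever the weight is positive.
    have hW : ∀ t ∈ kappa 𝕋, HasNablaDerivAt 𝕋
        (fun t => pairing 𝕋 a φ ψ p t - inner ℝ (c + Φ t) (p t))
        (max 0 (B - t) * ‖ψ t - Φ t - c‖ ^ 2) t := by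
      intro t ht
      have h1 := (hasNablaDerivAt_pairing h𝕋 hsup ha hφ hψ hpC t ht).sub
        (((hasNablaDerivAt_const c).add (hΦ t ht)).inner (hpd t ht) ht.1)
      convert h1 using 1
      rw [(hpd t ht).nablaDeriv_eq hsup ht, zero_add, add_sub_add_left_eq_sub, ← inner_sub_left,
        ← sub_sub, sub_right_comm, real_inner_smul_right, real_inner_self_eq_norm_sq]
    have hz := fun t ht => eq_zero_of_nonneg_of_antideriv_eq h𝕋 hW ha hT
      (fun t _ => mul_nonneg (le_max_left _ _) (sq_nonneg _))
      (by rw [hTp, pairing_self h𝕋 hsup ha hφ hψ hpC, hpB T hT hBT, hpa]; simp) (t := t) ht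
    have hfin : ∀ t ∈ 𝕋, a < t → t < B → ψ t - Φ t = c := by
      intro t ht hat htB
      have h1 := hz t ht hat (htB.le.trans hBT)
      rw [max_eq_right (by linarith)] at h1
      have h2 := (mul_eq_zero.1 h1).resolve_left (by linarith)
      rwa [sq_eq_zero_iff, norm_eq_zero, sub_eq_zero] at h2
    rw [hfin t₁ ht₁ h1 hB1, hfin t₂ ht₂ h2 hB2]
  obtain ⟨t₀, ht₀, hat₀⟩ := exists_mem_gt hsup a
  exact ⟨ψ t₀ - Φ t₀, fun t ht hat => by rw [← key t ht t₀ ht₀ hat hat₀, sub_add_cancel]⟩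

/-- For `t > B` also `ρ(t) ≥ B`, so `p^ρ` and `p^∇` vanish on `(B, T]`. The value of `p^∇` at `B`
itself, possibly nonzero, plays no role. -/
lemma pairing_eq_of_le (h𝕋 : IsClosed 𝕋) (hsup : ¬ BddAbove 𝕋) (ha : a ∈ 𝕋)
    (hφ : LdContinuous 𝕋 φ) (hψ : LdContinuous 𝕋 ψ) (hp : IsC1ld 𝕋 p) {B T : ℝ} (hB : B ∈ 𝕋)
    (hT : T ∈ 𝕋) (hBT : B ≤ T) (hpB : ∀ t ∈ 𝕋, B ≤ t → p t = 0) :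
    pairing 𝕋 a φ ψ p T = pairing 𝕋 a φ ψ p B := by
  refine eq_of_nablaDeriv_eq_zero h𝕋 (hasNablaDerivAt_pairing h𝕋 hsup ha hφ hψ hp) hB hT hBT
    fun t ht hBt _ => ?_
  have hr := hpB _ (rho_mem h𝕋 ht) (le_rho hB hBt)
  have hd : nablaDeriv 𝕋 p t = 0 := by
    refine (hp.hasNablaDerivAt t (mem_kappa_of_lt ht hB hBt)).unique_of_eqOn
      (S := 𝕋 ∩ Icc B t) inter_subset_left (frequently_ne_rho_left ht hB hBt)
      (hasNablaDerivAt_const 0) ?_ hr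
    filter_upwards [self_mem_nhdsWithin] with s hs using hpB s hs.1 hs.2.1
  rw [hr, hd, inner_zero_right, inner_zero_right, add_zero]

end DuBoisReymond

/-! ### Euler–Lagrange equations and transversality -/

section EulerLagrange

variable {n : ℕ} {𝕋 : Set ℝ} {a : ℝ}
  {L : ℝ → EuclideanSpace ℝ (Fin n) × EuclideanSpace ℝ (Fin n) × ℝ → ℝ}
  {g : ℝ → EuclideanSpace ℝ (Fin n) × EuclideanSpace ℝ (Fin n) → ℝ}
  {x p Φ : ℝ → EuclideanSpace ℝ (Fin n)} {xa c : EuclideanSpace ℝ (Fin n)} {k : ℝ}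

/-- The integrated Euler–Lagrange equations. Either `∫_a^T L_z` is eventually constant, or the
integrated equations also hold for `g`. -/
lemma exists_integrated_equations (h𝕋 : IsClosed 𝕋) (hsup : ¬ BddAbove 𝕋) (ha : a ∈ 𝕋)
    (hL : IsC1ldIntegrand 𝕋 L) (hg : IsC1ldIntegrand 𝕋 g) (hx : IsC1ld 𝕋 x)
    (h : ∀ p : ℝ → EuclideanSpace ℝ (Fin n), IsC1ld 𝕋 p → p a = 0 → ∀ T ∈ 𝕋, a < T →
      firstVar 𝕋 a L g x p T = 0) :
    ∃ k : ℝ, (∃ Φ : ℝ → EuclideanSpace ℝ (Fin n),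
        (∀ t ∈ kappa 𝕋, HasNablaDerivAt 𝕋 Φ (coeffX 𝕋 a L g x k t) t) ∧
        ∃ c, ∀ t ∈ 𝕋, a < t → coeffV 𝕋 a L g x k t = c + Φ t) ∧
      ((∃ B, ∀ T ∈ 𝕋, B ≤ T → intLz 𝕋 a L g x T = k) ∨
        ∃ Γ : ℝ → EuclideanSpace ℝ (Fin n),
          (∀ t ∈ kappa 𝕋, HasNablaDerivAt 𝕋 Γ (gx g t (jet 𝕋 x t)) t) ∧
          ∃ c, ∀ t ∈ 𝕋, a < t → gv g t (jet 𝕋 x t) = c + Γ t) := by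
  have hgx := hg.ldContinuous_gx (hx.ldContinuous_jet h𝕋)
  have hgv := hg.ldContinuous_gv (hx.ldContinuous_jet h𝕋)
  have hX := ldContinuous_coeffX h𝕋 hsup ha hL hg hx
  have hV := ldContinuous_coeffV h𝕋 hsup ha hL hg hx
  have heq : ∀ p : ℝ → EuclideanSpace ℝ (Fin n), IsC1ld 𝕋 p → p a = 0 → ∀ T ∈ 𝕋, a < T → ∀ k,
      (intLz 𝕋 a L g x T - k) *
        pairing 𝕋 a (fun t => gx g t (jet 𝕋 x t)) (fun t => gv g t (jet 𝕋 x t)) p T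
      + pairing 𝕋 a (coeffX 𝕋 a L g x k) (coeffV 𝕋 a L g x k) p T = 0 := fun p hp hpa T hT haT k =>
    (firstVar_eq h𝕋 hsup ha hL hg hx hp k hT).symm.trans (h p hp hpa T hT haT)
  -- If `β` always vanishes at the end of the support, the term in `K(T)` drops out and `k = 0`
  -- serves. Otherwise one `p` with `β(B) ≠ 0` is used to show that `K` is constant beyond `B`.
  by_cases hβ : ∀ p : ℝ → EuclideanSpace ℝ (Fin n), IsC1ld 𝕋 p → p a = 0 → ∀ B ∈ 𝕋, a < B →
      (∀ t ∈ 𝕋, B ≤ t → p t = 0) →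
      pairing 𝕋 a (fun t => gx g t (jet 𝕋 x t)) (fun t => gv g t (jet 𝕋 x t)) p B = 0
  · refine ⟨0, exists_eq_add_antideriv h𝕋 hsup ha (hX 0) (hV 0) fun p hp hpa B hB haB hpB =>
      ⟨B, hB, le_rfl, ?_⟩, Or.inr (exists_eq_add_antideriv h𝕋 hsup ha hgx hgv
        fun p hp hpa B hB haB hpB => ⟨B, hB, le_rfl, hβ p hp hpa B hB haB hpB⟩)⟩
    have := heq p hp hpa B hB haB 0
    rwa [hβ p hp hpa B hB haB hpB, mul_zero, zero_add] at this
  · push Not at hβ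
    obtain ⟨p, hp, hpa, B, hB, haB, hpB, hne⟩ := hβ
    have hK : ∀ T ∈ 𝕋, B ≤ T → intLz 𝕋 a L g x T = intLz 𝕋 a L g x B := by
      intro T hT hBT
      -- With `k = K(B)` the equation at `B` reads `α(B) = 0`. As `α` and `β` stay constant, the
      -- equation at `T` becomes `(K(T) - K(B)) β(B) = 0`.
      have h1 := heq p hp hpa B hB haB (intLz 𝕋 a L g x B)
      have h2 := heq p hp hpa T hT (haB.trans_le hBT) (intLz 𝕋 a L g x B)
      rw [sub_self, zero_mul, zero_add] at h1
      rw [pairing_eq_of_le h𝕋 hsup ha hgx hgv hp hB hT hBT hpB,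
        pairing_eq_of_le h𝕋 hsup ha (hX _) (hV _) hp hB hT hBT hpB, h1, add_zero] at h2
      exact sub_eq_zero.1 ((mul_eq_zero.1 h2).resolve_right hne)
    refine ⟨intLz 𝕋 a L g x B, exists_eq_add_antideriv h𝕋 hsup ha (hX _) (hV _)
      fun q hq hqa B' hB' haB' hqB' => ?_, Or.inl ⟨B, hK⟩⟩
    -- The factor `K(T) - k` is known to vanish only beyond `B`, hence a horizon `T` that may exceed
    -- the support of `q`.
    obtain ⟨T, hT, hTB⟩ := exists_mem_gt hsup (max B B')
    have hBT : B ≤ T := (le_max_left _ _).trans hTB.le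
    refine ⟨T, hT, (le_max_right _ _).trans hTB.le, ?_⟩
    have := heq q hq hqa T hT (haB.trans_le hBT) (intLz 𝕋 a L g x B)
    rwa [hK T hT hBT, sub_self, zero_mul, zero_add] at this

lemma limInf_eq_of_eventually (hsup : ¬ BddAbove 𝕋) {f : ℝ → ℝ} {r B : ℝ}
    (h : ∀ T ∈ 𝕋, B ≤ T → f T = r) : limInf 𝕋 f = r := by
  have hne : (atTop ⊓ 𝓟 𝕋 : Filter ℝ).NeBot := by
    rw [inf_principal_neBot_iff]
    intro U hU
    obtain ⟨b, hb⟩ := mem_atTop_sets.1 hU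
    obtain ⟨u, hu, hbu⟩ := exists_mem_gt hsup b
    exact ⟨u, hb u hbu.le, hu⟩
  have hev : ∀ᶠ T in atTop ⊓ 𝓟 𝕋, ((f T : ℝ) : EReal) = (r : EReal) := by
    rw [eventually_inf_principal]
    filter_upwards [eventually_ge_atTop B] with T hT hT'
    rw [h T hT' hT]
  rw [limInf, liminf_congr hev, liminf_const]

lemma nablaIntegral_Lz_eq (h𝕋 : IsClosed 𝕋) (hsup : ¬ BddAbove 𝕋) (ha : a ∈ 𝕋)
    (hL : IsC1ldIntegrand 𝕋 L) (hg : IsC1ldIntegrand 𝕋 g) (hx : IsC1ld 𝕋 x) {s T : ℝ}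
    (hs : s ∈ 𝕋) (hT : T ∈ 𝕋) :
    nablaIntegral 𝕋 (fun τ => Lz L τ (jetz 𝕋 a g x τ)) (rho 𝕋 s) T
      = intLz 𝕋 a L g x T - intLz 𝕋 a L g x (rho 𝕋 s) :=
  (hL.ldContinuous_Lz (hx.ldContinuous_jetz h𝕋 hsup ha hg)).nablaIntegral_sub_left h𝕋 hsup ha
    (rho_mem h𝕋 hs) hT

/-- `K ∘ ρ` need not be nabla differentiable. The integrated equation trades it for `Φ`, `L_v` and
`g_v`, which are. -/
lemma gvTerm_eq (h𝕋 : IsClosed 𝕋) (hsup : ¬ BddAbove 𝕋) (ha : a ∈ 𝕋)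
    (hL : IsC1ldIntegrand 𝕋 L) (hg : IsC1ldIntegrand 𝕋 g) (hx : IsC1ld 𝕋 x) {s T : ℝ}
    (hs : s ∈ 𝕋) (hT : T ∈ 𝕋) (hV : coeffV 𝕋 a L g x k s = c + Φ s) :
    gvTerm 𝕋 a L g x T s = (intLz 𝕋 a L g x T - k) • gv g s (jet 𝕋 x s) + (c + Φ s)
      - Lv L s (jetz 𝕋 a g x s) := by
  rw [gvTerm, nablaIntegral_Lz_eq h𝕋 hsup ha hL hg hx hs hT, ← hV, coeffV]
  module

lemma hasNablaDerivAt_gvTerm_formula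
    (hLv : NablaDifferentiable 𝕋 (fun t => Lv L t (jetz 𝕋 a g x t)))
    (hgv : NablaDifferentiable 𝕋 (fun t => gv g t (jet 𝕋 x t)))
    (hΦ : ∀ t ∈ kappa 𝕋, HasNablaDerivAt 𝕋 Φ (coeffX 𝕋 a L g x k t) t) (T : ℝ) {t : ℝ}
    (ht : t ∈ kappa 𝕋) :
    HasNablaDerivAt 𝕋 (fun s => (intLz 𝕋 a L g x T - k) • gv g s (jet 𝕋 x s) + (c + Φ s)
        - Lv L s (jetz 𝕋 a g x s))
      ((intLz 𝕋 a L g x T - k) • nablaDeriv 𝕋 (fun t => gv g t (jet 𝕋 x t)) t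
        + coeffX 𝕋 a L g x k t - nablaDeriv 𝕋 (fun t => Lv L t (jetz 𝕋 a g x t)) t) t := by
  have h := (((hgv t ht).hasNablaDerivAt.const_smul (intLz 𝕋 a L g x T - k)).add
    ((hasNablaDerivAt_const c).add (hΦ t ht))).sub (hLv t ht).hasNablaDerivAt
  rwa [zero_add] at h

/-- The nabla derivative at `t` involves the value at `ρ(t)`, so the integrated equation is needed
there too; hence the condition `ρ(t) > a` in the theorem. -/
lemma nablaDifferentiableAt_gvTerm (h𝕋 : IsClosed 𝕋) (hsup : ¬ BddAbove 𝕋) (ha : a ∈ 𝕋)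
    (hL : IsC1ldIntegrand 𝕋 L) (hg : IsC1ldIntegrand 𝕋 g) (hx : IsC1ld 𝕋 x)
    (hLv : NablaDifferentiable 𝕋 (fun t => Lv L t (jetz 𝕋 a g x t)))
    (hgv : NablaDifferentiable 𝕋 (fun t => gv g t (jet 𝕋 x t)))
    (hΦ : ∀ t ∈ kappa 𝕋, HasNablaDerivAt 𝕋 Φ (coeffX 𝕋 a L g x k t) t) {t : ℝ}
    (ht : t ∈ kappa 𝕋) (hev : ∀ᶠ s in 𝓝[𝕋] t, coeffV 𝕋 a L g x k s = c + Φ s)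
    (hr : coeffV 𝕋 a L g x k (rho 𝕋 t) = c + Φ (rho 𝕋 t)) {T : ℝ} (hT : T ∈ 𝕋) :
    NablaDifferentiableAt 𝕋 (gvTerm 𝕋 a L g x T) t := by
  refine ⟨ht, _, (hasNablaDerivAt_gvTerm_formula (c := c) hLv hgv hΦ T ht).congr ?_
    (gvTerm_eq h𝕋 hsup ha hL hg hx (rho_mem h𝕋 ht.1) hT hr).symm⟩
  filter_upwards [hev, self_mem_nhdsWithin] with s hs hs'
  exact (gvTerm_eq h𝕋 hsup ha hL hg hx hs' hT hs).symm

/-- The integrated equations on a set accumulating at `t` give the Euler–Lagrange equations. -/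
lemma eulerLagrangeAt_of_integrated (h𝕋 : IsClosed 𝕋) (hsup : ¬ BddAbove 𝕋) (ha : a ∈ 𝕋)
    (hL : IsC1ldIntegrand 𝕋 L) (hg : IsC1ldIntegrand 𝕋 g) (hx : IsC1ld 𝕋 x)
    (hLv : NablaDifferentiable 𝕋 (fun t => Lv L t (jetz 𝕋 a g x t)))
    (hgv : NablaDifferentiable 𝕋 (fun t => gv g t (jet 𝕋 x t)))
    (hΦ : ∀ t ∈ kappa 𝕋, HasNablaDerivAt 𝕋 Φ (coeffX 𝕋 a L g x k t) t) {t : ℝ}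
    (ht : t ∈ kappa 𝕋) {S : Set ℝ} (hS : S ⊆ 𝕋) (hfr : ∃ᶠ u in 𝓝[S] t, u ≠ rho 𝕋 t)
    (hrS : rho 𝕋 t ∈ S) (hV : ∀ s ∈ S, coeffV 𝕋 a L g x k s = c + Φ s)
    (hD : (∃ B, ∀ T ∈ 𝕋, B ≤ T → intLz 𝕋 a L g x T = k) ∨
      ∃ Γ : ℝ → EuclideanSpace ℝ (Fin n),
        (∀ t ∈ kappa 𝕋, HasNablaDerivAt 𝕋 Γ (gx g t (jet 𝕋 x t)) t) ∧
        ∃ c, ∀ s ∈ S, gv g s (jet 𝕋 x s) = c + Γ s)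
    (hdiff : ∀ T ∈ 𝕋, NablaDifferentiableAt 𝕋 (gvTerm 𝕋 a L g x T) t) :
    EulerLagrangeAt 𝕋 a L g x t := by
  have hd : ∀ T ∈ 𝕋, nablaDeriv 𝕋 (gvTerm 𝕋 a L g x T) t
      = (intLz 𝕋 a L g x T - k) • nablaDeriv 𝕋 (fun t => gv g t (jet 𝕋 x t)) t
        + coeffX 𝕋 a L g x k t - nablaDeriv 𝕋 (fun t => Lv L t (jetz 𝕋 a g x t)) t := by
    intro T hT
    refine (hdiff T hT).hasNablaDerivAt.unique_of_eqOn hS hfr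
      (hasNablaDerivAt_gvTerm_formula (c := c) hLv hgv hΦ T ht) ?_
      (gvTerm_eq h𝕋 hsup ha hL hg hx (hS hrS) hT (hV _ hrS))
    filter_upwards [self_mem_nhdsWithin] with s hs
    exact gvTerm_eq h𝕋 hsup ha hL hg hx (hS hs) hT (hV s hs)
  -- This is the only part of the equation that depends on `T`; the alternative in `hD` says which
  -- factor vanishes.
  have hz : ∃ B, ∀ T ∈ 𝕋, B ≤ T → (intLz 𝕋 a L g x T - k) • (gx g t (jet 𝕋 x t)
      - nablaDeriv 𝕋 (fun t => gv g t (jet 𝕋 x t)) t) = 0 := by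
    rcases hD with ⟨B, hB⟩ | ⟨Γ, hΓ, c₁, hc₁⟩
    · exact ⟨B, fun T hT hBT => by rw [hB T hT hBT, sub_self, zero_smul]⟩
    · refine ⟨0, fun T _ _ => ?_⟩
      have h1 := (hasNablaDerivAt_const c₁).add (hΓ t ht)
      rw [zero_add] at h1
      rw [(hgv t ht).hasNablaDerivAt.unique_of_eqOn hS hfr h1
        (by filter_upwards [self_mem_nhdsWithin] with s hs using hc₁ s hs) (hc₁ _ hrS),
        sub_self, smul_zero]
  obtain ⟨B, hB⟩ := hz
  intro i
  rw [limInf_eq_of_eventually hsup (B := B) (r := -(Lx L t (jetz 𝕋 a g x t)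
    - nablaDeriv 𝕋 (fun s => Lv L s (jetz 𝕋 a g x s)) t) i), ← EReal.coe_add, neg_add_cancel,
    EReal.coe_zero]
  intro T hT hBT
  rw [hd T hT, nablaIntegral_Lz_eq h𝕋 hsup ha hL hg hx ht.1 hT, ← PiLp.neg_apply]
  refine congrArg (fun v : EuclideanSpace ℝ (Fin n) => v i) ?_
  rw [← sub_eq_zero, ← hB T hT hBT, coeffX]
  module

/-- Two ld-continuous functions which agree on the right of a dense point agree at that point. -/
lemma LdContinuous.eq_of_eqOn_right (hsup : ¬ BddAbove 𝕋) {F : Type*} [NormedAddCommGroup F]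
    {f f₁ : ℝ → F} (hf : LdContinuous 𝕋 f) (hf₁ : LdContinuous 𝕋 f₁) (ha : a ∈ 𝕋)
    (hr : rho 𝕋 a = a) (hs : sigma 𝕋 a = a) (h : ∀ t ∈ 𝕋, a < t → f t = f₁ t) : f a = f₁ a := by
  have hne : (𝓝[𝕋 ∩ Ioi a] a).NeBot := by
    rw [← mem_closure_iff_nhdsWithin_neBot, Metric.mem_closure_iff]
    intro ε hε
    obtain ⟨b, hb, hab⟩ := exists_mem_gt hsup a
    obtain ⟨u, hu, hau, hue⟩ := exists_mem_Ioo_of_sigma_eq hs hb hab (lt_add_of_pos_right a hε)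
    exact ⟨u, ⟨hu, hau⟩, by rw [dist_comm, Real.dist_eq, abs_lt]; constructor <;> linarith⟩
  have h1 := ((hf a ha).1 hr).mono_left (nhdsWithin_mono a (inter_subset_left (t := Ioi a)))
  have h2 := ((hf₁ a ha).1 hr).mono_left (nhdsWithin_mono a (inter_subset_left (t := Ioi a)))
  refine tendsto_nhds_unique h1 (h2.congr' ?_)
  filter_upwards [self_mem_nhdsWithin] with t ht using (h t ht.1 ht.2).symm

/-- The boundary term of the transversality condition vanishes at every large point. -/
lemma exists_inner_boundary_eq_zero (h𝕋 : IsClosed 𝕋) (hsup : ¬ BddAbove 𝕋) (ha : a ∈ 𝕋)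
    (hL : IsC1ldIntegrand 𝕋 L) (hg : IsC1ldIntegrand 𝕋 g) (hx : IsC1ld 𝕋 x)
    (h : ∀ p : ℝ → EuclideanSpace ℝ (Fin n), IsC1ld 𝕋 p → p a = 0 → ∀ T ∈ 𝕋, a < T →
      firstVar 𝕋 a L g x p T = 0)
    (hΦ : ∀ t ∈ kappa 𝕋, HasNablaDerivAt 𝕋 Φ (coeffX 𝕋 a L g x k t) t)
    (hV : ∀ s ∈ 𝕋, a < s → coeffV 𝕋 a L g x k s = c + Φ s)
    (hD : (∃ B, ∀ T ∈ 𝕋, B ≤ T → intLz 𝕋 a L g x T = k) ∨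
      ∃ Γ : ℝ → EuclideanSpace ℝ (Fin n),
        (∀ t ∈ kappa 𝕋, HasNablaDerivAt 𝕋 Γ (gx g t (jet 𝕋 x t)) t) ∧
        ∃ c, ∀ s ∈ 𝕋, a < s → gv g s (jet 𝕋 x s) = c + Γ s) :
    ∃ B, ∀ T ∈ 𝕋, B ≤ T → inner ℝ (x T) (Lv L T (jetz 𝕋 a g x T)
        + (nu 𝕋 T * Lz L T (jetz 𝕋 a g x T)) • gv g T (jet 𝕋 x T)) = 0 := by
  obtain ⟨t₁, ht₁, hat₁⟩ := exists_mem_gt hsup a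
  obtain ⟨B, hB, htB⟩ := exists_mem_gt hsup t₁
  obtain ⟨X, hX, hXB⟩ := exists_weight_antideriv h𝕋 hsup ha ht₁ hB hat₁ htB
  -- The ramp `(X t - X a) / (X B - X a)` rises from `0` at `a` to `1` at `B` and stays there, so
  -- `p(a) = 0` while `p = x` from `B` on.
  let p : ℝ → EuclideanSpace ℝ (Fin n) := fun t =>
    x t - x a + ((X B - X a)⁻¹ * (X t - X a)) • x a
  have hpd : ∀ t ∈ kappa 𝕋, HasNablaDerivAt 𝕋 p
      (nablaDeriv 𝕋 x t + ((X B - X a)⁻¹ * max 0 (B - t)) • x a) t := by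
    intro t ht
    have h1 := ((hx.hasNablaDerivAt t ht).sub (hasNablaDerivAt_const (x a))).add
      ((((hX t ht).sub (hasNablaDerivAt_const (X a))).const_smul (X B - X a)⁻¹).clm
          ((ContinuousLinearMap.id ℝ ℝ).smulRight (x a)))
    simpa using h1
  have hp : IsC1ld 𝕋 p := isC1ld_of_hasNablaDerivAt hsup
    (hx.2.add (.of_continuousOn (by fun_prop))) hpd
  have hpa : p a = 0 := by simp [p]
  have hpB : ∀ t ∈ 𝕋, B ≤ t → p t = x t := by
    intro t ht hBt
    have : X t = X B := eq_of_nablaDeriv_eq_zero h𝕋 hX hB ht hBt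
      fun s _ hs _ => max_eq_left (by linarith)
    simp only [p]
    rw [this, inv_mul_cancel₀ hXB, one_smul, sub_add_cancel]
  have hgx := hg.ldContinuous_gx (hx.ldContinuous_jet h𝕋)
  have hgv := hg.ldContinuous_gv (hx.ldContinuous_jet h𝕋)
  have key : ∀ T ∈ 𝕋, B ≤ T → (intLz 𝕋 a L g x T - k) *
      pairing 𝕋 a (fun t => gx g t (jet 𝕋 x t)) (fun t => gv g t (jet 𝕋 x t)) p T
      = (intLz 𝕋 a L g x T - k) * inner ℝ (gv g T (jet 𝕋 x T)) (x T) →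
      inner ℝ (x T) (Lv L T (jetz 𝕋 a g x T)
        + (nu 𝕋 T * Lz L T (jetz 𝕋 a g x T)) • gv g T (jet 𝕋 x T)) = 0 := by
    intro T hT hBT he
    have haT : a < T := hat₁.trans (htB.trans_le hBT)
    have h1 := firstVar_eq h𝕋 hsup ha hL hg hx hp k hT
    rw [h p hp hpa T hT haT, he, pairing_eq_inner h𝕋 hsup ha
      (ldContinuous_coeffX h𝕋 hsup ha hL hg hx k) (ldContinuous_coeffV h𝕋 hsup ha hL hg hx k)
      hΦ hV hp hpa hT haT, hpB T hT hBT, coeffV] at h1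
    -- The boundary term carries `K(T) - K(ρ(T))`, which is `ν(T) L_z(T)`.
    have h2 := (hasNablaDerivAt_intLz h𝕋 hsup ha hL hg hx T
      (mem_kappa_of_lt hT ha haT)).eq_of_rho_lt hT
    rw [smul_eq_mul, ← nu] at h2
    rw [← h2, real_inner_comm]
    simp only [inner_add_left, real_inner_smul_left] at h1 ⊢
    linarith
  rcases hD with ⟨B', hB'⟩ | ⟨Γ, hΓ, c₁, hc₁⟩
  · refine ⟨max B B', fun T hT hBT => key T hT ((le_max_left _ _).trans hBT) ?_⟩
    rw [hB' T hT ((le_max_right _ _).trans hBT), sub_self, zero_mul, zero_mul]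
  · refine ⟨B, fun T hT hBT => key T hT hBT ?_⟩
    rw [pairing_eq_inner h𝕋 hsup ha hgx hgv hΓ hc₁ hp hpa hT (hat₁.trans (htB.trans_le hBT)),
      hpB T hT hBT]

end EulerLagrange

end TimeScale

/-! ### The main theorem -/

theorem mainTheorem1 (𝕋 : Set ℝ) (h𝕋 : IsClosed 𝕋) (hsup : ¬ BddAbove 𝕋)
    (a : ℝ) (ha : a ∈ 𝕋) (n : ℕ) (xa : EuclideanSpace ℝ (Fin n))
    (L : ℝ → EuclideanSpace ℝ (Fin n) × EuclideanSpace ℝ (Fin n) × ℝ → ℝ)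
    (g : ℝ → EuclideanSpace ℝ (Fin n) × EuclideanSpace ℝ (Fin n) → ℝ)
    (hL : TimeScale.IsC1ldIntegrand 𝕋 L) (hg : TimeScale.IsC1ldIntegrand 𝕋 g)
    (xs : ℝ → EuclideanSpace ℝ (Fin n))
    (hLv : TimeScale.NablaDifferentiable 𝕋
      (fun t => TimeScale.Lv L t (TimeScale.jetz 𝕋 a g xs t)))
    (hgv : TimeScale.NablaDifferentiable 𝕋
      (fun t => TimeScale.gv g t (TimeScale.jet 𝕋 xs t)))
    (hmax : TimeScale.IsWeakMaximizer 𝕋 a xa L g xs)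
    -- (1) `lim_{ε → 0} V(ε, T) / ε` exists for all `T`
    (h1 : ∀ p : ℝ → EuclideanSpace ℝ (Fin n), TimeScale.IsC1ld 𝕋 p → p a = 0 →
      ∀ T ∈ 𝕋, a < T → ∃ l : ℝ,
        Tendsto (fun ε : ℝ => TimeScale.infV 𝕋 a L g xs p ε T / (ε : EReal))
          (𝓝[≠] 0) (𝓝 (l : EReal)))
    -- (2) `lim_{T → ∞} V(ε, T) / ε` exists uniformly for `ε ≠ 0` near `0`
    (h2 : ∀ p : ℝ → EuclideanSpace ℝ (Fin n), TimeScale.IsC1ld 𝕋 p → p a = 0 →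
      ∃ ε₀ : ℝ, 0 < ε₀ ∧ ∃ W : ℝ → ℝ, ∀ η : ℝ, 0 < η → ∃ T₀ : ℝ, ∀ T ∈ 𝕋, T₀ ≤ T →
        ∀ ε : ℝ, ε ≠ 0 → |ε| < ε₀ →
          ((W ε - η : ℝ) : EReal) ≤ TimeScale.infV 𝕋 a L g xs p ε T / (ε : EReal) ∧
          TimeScale.infV 𝕋 a L g xs p ε T / (ε : EReal) ≤ ((W ε + η : ℝ) : EReal))
    -- (3) `A(ε, T'_k) → inf_{T' ≥ T} A(ε, T')` uniformly for small `ε > 0`, for some sequence `T'_k`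
    (h3 : ∀ p : ℝ → EuclideanSpace ℝ (Fin n), TimeScale.IsC1ld 𝕋 p → p a = 0 →
      ∀ T ∈ 𝕋, a < T → ∃ ε₀ : ℝ, 0 < ε₀ ∧ ∃ S : ℕ → ℝ, (∀ k, S k ∈ 𝕋 ∧ T ≤ S k) ∧
        ∃ m : ℝ → ℝ,
          (∀ ε ∈ Ioo 0 ε₀, IsGLB (TimeScale.quotA 𝕋 a L g xs p ε '' (𝕋 ∩ Ici T)) (m ε)) ∧
          TendstoUniformlyOn (fun k ε => TimeScale.quotA 𝕋 a L g xs p ε (S k)) m atTop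
            (Ioo 0 ε₀)) :
    (∀ t ∈ 𝕋, (a < TimeScale.rho 𝕋 t ∨ (t = a ∧ IsLeast 𝕋 a ∧ TimeScale.sigma 𝕋 a = a)) →
      (∀ T' ∈ 𝕋, TimeScale.NablaDifferentiableAt 𝕋 (TimeScale.gvTerm 𝕋 a L g xs T') t) ∧
      TimeScale.EulerLagrangeAt 𝕋 a L g xs t) ∧
    (TimeScale.rho 𝕋 a = a → TimeScale.sigma 𝕋 a = a →
      (∀ T' ∈ 𝕋, TimeScale.NablaDifferentiableAt 𝕋 (TimeScale.gvTerm 𝕋 a L g xs T') a) →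
      TimeScale.EulerLagrangeAt 𝕋 a L g xs a) ∧
    TimeScale.limInf 𝕋 (fun T' =>
      inner ℝ (xs T') (TimeScale.Lv L T' (TimeScale.jetz 𝕋 a g xs T')
        + (TimeScale.nu 𝕋 T' * TimeScale.Lz L T' (TimeScale.jetz 𝕋 a g xs T')) •
          TimeScale.gv g T' (TimeScale.jet 𝕋 xs T'))) = 0 := by
  have hx := hmax.1.1
  have hvar : ∀ p : ℝ → EuclideanSpace ℝ (Fin n), TimeScale.IsC1ld 𝕋 p → p a = 0 →
      ∀ T ∈ 𝕋, a < T → TimeScale.firstVar 𝕋 a L g xs p T = 0 := fun p hp hpa T hT haT =>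
    hmax.firstVar_eq_zero h𝕋 hsup ha hL hg hp hpa hT haT (h1 p hp hpa T hT haT)
  obtain ⟨k, ⟨Φ, hΦ, c, hV⟩, hD⟩ :=
    TimeScale.exists_integrated_equations h𝕋 hsup ha hL hg hx hvar
  -- When `a` is dense on both sides in the sense of `ρ` and `σ`, ld-continuity carries the
  -- integrated equations from `(a, ∞)` to `a`. They say nothing to the left of `a`, so
  -- differentiability of `gvTerm` at `a` must be given unless `a` is the minimum.
  have hdense : TimeScale.rho 𝕋 a = a → TimeScale.sigma 𝕋 a = a →
      (∀ s ∈ 𝕋 ∩ Ici a, TimeScale.coeffV 𝕋 a L g xs k s = c + Φ s) ∧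
      ((∃ B, ∀ T ∈ 𝕋, B ≤ T → TimeScale.intLz 𝕋 a L g xs T = k) ∨
        ∃ Γ : ℝ → EuclideanSpace ℝ (Fin n), (∀ t ∈ TimeScale.kappa 𝕋,
          TimeScale.HasNablaDerivAt 𝕋 Γ (TimeScale.gx g t (TimeScale.jet 𝕋 xs t)) t) ∧
          ∃ c, ∀ s ∈ 𝕋 ∩ Ici a, TimeScale.gv g s (TimeScale.jet 𝕋 xs s) = c + Γ s) := by
    intro hr hs
    have hext : ∀ {f f₁ f' : ℝ → EuclideanSpace ℝ (Fin n)} {c : EuclideanSpace ℝ (Fin n)},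
        TimeScale.LdContinuous 𝕋 f →
        (∀ t ∈ TimeScale.kappa 𝕋, TimeScale.HasNablaDerivAt 𝕋 f₁ (f' t) t) →
        (∀ s ∈ 𝕋, a < s → f s = c + f₁ s) → ∀ s ∈ 𝕋 ∩ Ici a, f s = c + f₁ s := by
      intro f f₁ f' c hf hf₁ h s hs'
      rcases (mem_Ici.1 hs'.2).eq_or_lt with rfl | has
      · exact hf.eq_of_eqOn_right hsup (.of_continuousOn (continuousOn_const.add
          (TimeScale.continuousOn_of_hasNablaDerivAt hf₁))) ha hr hs h
      · exact h s hs'.1 has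
    refine ⟨hext (TimeScale.ldContinuous_coeffV h𝕋 hsup ha hL hg hx k) hΦ hV, hD.imp_right ?_⟩
    rintro ⟨Γ, hΓ, c₁, hc₁⟩
    exact ⟨Γ, hΓ, c₁, hext (hg.ldContinuous_gv (hx.ldContinuous_jet h𝕋)) hΓ hc₁⟩
  have hEL : TimeScale.rho 𝕋 a = a → TimeScale.sigma 𝕋 a = a →
      (∀ T' ∈ 𝕋, TimeScale.NablaDifferentiableAt 𝕋 (TimeScale.gvTerm 𝕋 a L g xs T') a) →
      TimeScale.EulerLagrangeAt 𝕋 a L g xs a := by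
    intro hr hs hdiff
    obtain ⟨hV', hD'⟩ := hdense hr hs
    exact TimeScale.eulerLagrangeAt_of_integrated h𝕋 hsup ha hL hg hx hLv hgv hΦ
      (TimeScale.mem_kappa_of_sigma_eq ha hs) inter_subset_left
      (by rw [hr]; exact TimeScale.frequently_ne_of_sigma_eq hsup hs)
      (by rw [hr]; exact ⟨ha, self_mem_Ici⟩) hV' hD' hdiff
  refine ⟨fun t ht hcase => ?_, hEL, ?_⟩
  · rcases hcase with hat | ⟨rfl, hmin, hs⟩
    · have hat' : a < t := hat.trans_le (TimeScale.rho_le 𝕋 t)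
      have hk := TimeScale.mem_kappa_of_lt ht ha hat'
      have hrm := TimeScale.rho_mem h𝕋 ht
      have hdiff : ∀ T' ∈ 𝕋,
          TimeScale.NablaDifferentiableAt 𝕋 (TimeScale.gvTerm 𝕋 a L g xs T') t := by
        refine fun T' hT' => TimeScale.nablaDifferentiableAt_gvTerm h𝕋 hsup ha hL hg hx hLv hgv hΦ
          hk ?_ (hV _ hrm hat) hT'
        filter_upwards [self_mem_nhdsWithin, mem_nhdsWithin_of_mem_nhds (Ioi_mem_nhds hat')]
          with s hs has using hV s hs has
      refine ⟨hdiff, TimeScale.eulerLagrangeAt_of_integrated h𝕋 hsup ha hL hg hx hLv hgv hΦ hk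
        (S := 𝕋 ∩ Ioi a) inter_subset_left ?_ ⟨hrm, hat⟩ (fun s hs => hV s hs.1 hs.2)
        (hD.imp_right fun ⟨Γ, hΓ, c₁, hc₁⟩ => ⟨Γ, hΓ, c₁, fun s hs => hc₁ s hs.1 hs.2⟩) hdiff⟩
      rw [nhdsWithin_inter_of_mem' (mem_nhdsWithin_of_mem_nhds (Ioi_mem_nhds hat'))]
      exact TimeScale.frequently_ne_rho hsup hk
    · have hr : TimeScale.rho 𝕋 t = t := (TimeScale.rho_le 𝕋 t).antisymm
        (hmin.2 (TimeScale.rho_mem h𝕋 ht))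
      have hV' := (hdense hr hs).1
      have hdiff : ∀ T' ∈ 𝕋,
          TimeScale.NablaDifferentiableAt 𝕋 (TimeScale.gvTerm 𝕋 t L g xs T') t := by
        refine fun T' hT' => TimeScale.nablaDifferentiableAt_gvTerm h𝕋 hsup ha hL hg hx hLv hgv hΦ
          (TimeScale.mem_kappa_of_sigma_eq ht hs) ?_
          (by rw [hr]; exact hV' t ⟨ht, self_mem_Ici⟩) hT'
        filter_upwards [self_mem_nhdsWithin] with s hs' using hV' s ⟨hs', hmin.2 hs'⟩
      exact ⟨hdiff, hEL hr hs hdiff⟩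
  · obtain ⟨B, hB⟩ := TimeScale.exists_inner_boundary_eq_zero h𝕋 hsup ha hL hg hx hvar hΦ hV hD
    exact TimeScale.limInf_eq_of_eventually hsup hB
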